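/- **Polytope complexes.** A *polytope complex* $\mathcal C$ is a small double category (objects, vertical morphisms $a\dashrightarrow b$, horizontal morphisms $a\to b$, and a class of commutative squares with horizontal top and bottom and vertical sides, containing the identity squares and closed under horizontal and vertical composition) such that: * (V) vertically $\mathcal C$ is a preorder with a unique initial object $\varnothing$ and with pullbacks, and it carries a Grothendieck topology; every covering family of an object $a\neq\varnothing$ contains some $a_i\dashrightarrow a$ with $a_i\ne\varnothing$; * (H) horizontally $\mathcal C$ is a groupoid; * (P) every pair consisting of a horizontal $\Sigma:a\to b$ and a vertical $b'\dashrightarrow b$ can be completed to a commutative square with left side $\Sigma^*b'\dashrightarrow a$ and top $\Sigma^*b'\to b'$. The completing square is unique up to vertical isomorphism: for two completions $\tau_1:a_1\to b'$ and $\tau_2:a_2\to b'$ there is a vertical $a_1\dashrightarrow a_2$ forming, with $\tau_1$, $\tau_2$ and $\mathrm{id}_{b'}$, a commutative square. The top morphism is determined by the other three sides. The resulting functor $\Sigma^*:(\mathcal C_v\downarrow b)\to(\mathcal C_v\downarrow a)$ is an equivalence; * (C) if $\{x_\alpha\dashrightarrow x\}$ is a covering family and $\Sigma:y\to x$ is horizontal,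 then $\{\Sigma^*x_\alpha\dashrightarrow y\}$ is a covering family; * (B) if $\{x_{\alpha\beta}\dashrightarrow x_\alpha\}_\beta$ is a covering family for each $\alpha$ and $\{x_{\alpha\beta}\dashrightarrow x\}_{\alpha,\beta}$ is a covering family, then so is $\{x_\alpha\dashrightarrow x\}_\alpha$. The *polytopes* of $\mathcal C$ are the objects $\neq\varnothing$. A *polytope functor* is a double functor which vertically preserves $\varnothing$, pullbacks and covering families (and hence preserves the squares of (P)). Polytope complexes and polytope functors form a category $\mathbf{PolyCpx}$. **The category $SC(\mathcal C)$.** Its objects are finite families $\{a_i\}_{i\in I}$ of polytopes, the index sets being finite sets of natural numbers. A *sub-map* $p:\{a_i\}_{i\in I}\dashrightarrow\{b_j\}_{j\in J}$ is a map $p:I\to J$ with vertical morphisms $a_i\dashrightarrow b_{p(i)}$ such that $a_i\times_{b_j}a_{i'}=\varnothing$ for distinct $i,i'\in p^{-1}(j)$; it is *covering* if $\{a_i\dashrightarrow b_j\}_{i\in p^{-1}(j)}$ is a covering family for every $j\in J$. A *shuffle* $\sigma:\{a_i\}_{i\in I}\to\{b_j\}_{j\in J}$ is a map $\sigma:I\to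 J$ with horizontal morphisms $\Sigma_i:a_i\to b_{\sigma(i)}$. A morphism $A\to B$ of $SC(\mathcal C)$ is a class of diagrams $A\overset{p}{\dashleftarrow}A'\overset{\sigma}{\to}B$ ($p$ a sub-map, $\sigma$ a shuffle), up to vertical isomorphisms of $A'$ (bijections of the index sets with vertical isomorphisms of the components) compatible with $p$ and $\sigma$. The composite with $B\overset{q}{\dashleftarrow}B'\overset{\tau}{\to}D$ is $A\dashleftarrow A'\dashleftarrow\sigma^*B'\to B'\to D$, where $\sigma^*B'=\{\Sigma_i^*b'_j\}_{\sigma(i)=q(j)}$. The morphism is a *cofibration* (resp. *weak equivalence*) if $p$ is covering and $\sigma$ is injective (resp. bijective) on index sets. A polytope functor $F$ induces $SC(F)$, which sends $\{a_i\}$ to $\{F(a_i)\}$, omitting the indices with $F(a_i)=\varnothing$, and acts accordingly on diagrams. **Theorem.** $SC$ is a functor from $\mathbf{PolyCpx}$ to the category of Waldhausen categories and exact functors. Each Waldhausen category $SC(\mathcal C)$ satisfies * the saturation axiom: if two of $f,g,gf$ are weak equivalences, so is the third; * the extension axiom: if a map of cofibration sequences $(A\to B\to B/A)\to(A'\to B'\to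 B'/A')$ is a weak equivalence on $A\to A'$ and on $B/A\to B'/A'$, then $B\to B'$ is a weak equivalence; * canonical splitting: for every cofibration sequence $A\to B\to B/A$ the map $B\to B/A$ has exactly one section, this section is a cofibration, and the induced map $A\amalg B/A\to B$ is a weak equivalence. Moreover $[a]\mapsto[\{a\}]$ defines an isomorphism onto $K_0SC(\mathcal C)$ from the free abelian group on the polytopes of $\mathcal C$ modulo the relations $[a]=\sum_{i\in I}[a_i]$ for covering sub-maps $\{a_i\}_{i\in I}\dashrightarrow\{a\}$ and $[a]=[b]$ for horizontal morphisms $a\to b$. Here $K_0$ of a Waldhausen category is the free abelian group on its objects modulo $[A]=[B]$ for weak equivalences $A\to B$ and $[B]=[A]+[B/A]$ for cofibration sequences $A\to B\to B/A$. -/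

import Mathlib

open CategoryTheory CategoryTheory.Limits

universe w v u v' u'

/-! ## Double categories that are vertically a preorder -/

/-- A double category whose vertical category is a preorder: a vertical morphism `a ⇢ b` is the
relation `a ≤ b`.  Horizontal morphisms form a category, and `Sq σ τ` says that the square

    a --σ--> b
    ⋮        ⋮
    c --τ--> d

(with vertical sides `a ≤ c` and `b ≤ d`) is one of the commutative squares. -/
structure DoublePreorder where
  Ob : Type u
  [vert : Preorder Ob]
  Hor : Ob → Ob → Type v
  hid : ∀ a, Hor a a
  hcomp : ∀ {a b c}, Hor a b → Hor b c → Hor a c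
  hid_comp : ∀ {a b} (σ : Hor a b), hcomp (hid a) σ = σ
  hcomp_id : ∀ {a b} (σ : Hor a b), hcomp σ (hid b) = σ
  hassoc : ∀ {a b c d} (σ : Hor a b) (τ : Hor b c) (ρ : Hor c d),
    hcomp (hcomp σ τ) ρ = hcomp σ (hcomp τ ρ)
  Sq : ∀ {a b c d}, Hor a b → Hor c d → Prop
  sq_left : ∀ {a b c d} {σ : Hor a b} {τ : Hor c d}, Sq σ τ → a ≤ c
  sq_right : ∀ {a b c d} {σ : Hor a b} {τ : Hor c d}, Sq σ τ → b ≤ d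
  sq_vid : ∀ {a b} (σ : Hor a b), Sq σ σ
  sq_hid : ∀ {a c}, a ≤ c → Sq (hid a) (hid c)
  sq_vcomp : ∀ {a b c d e f} {σ : Hor a b} {τ : Hor c d} {ρ : Hor e f},
    Sq σ τ → Sq τ ρ → Sq σ ρ
  sq_hcomp : ∀ {a b c d e f} {σ : Hor a b} {σ' : Hor b c} {τ : Hor d e} {τ' : Hor e f},
    Sq σ τ → Sq σ' τ' → Sq (hcomp σ σ') (hcomp τ τ')

attribute [instance] DoublePreorder.vert

/-- The family `x i ⇢ a` of vertical morphisms is a covering family of `a`: the sieve it generates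
is covering. -/
def IsCoveringFamily {X : Type u} [Preorder X] (J : GrothendieckTopology X) {ι : Type w}
    (x : ι → X) (a : X) : Prop :=
  ∃ h : ∀ i, x i ≤ a, Sieve.ofArrows x (fun i => homOfLE (h i)) ∈ J a

/-! ## Polytope complexes -/

/-- A polytope complex. -/
structure PolytopeComplex extends DoublePreorder.{v, u} where
  /-- (V) the unique (vertically) initial object -/
  bot : Ob
  bot_le : ∀ a, bot ≤ a
  eq_bot : ∀ {a}, a ≤ bot → a = bot
  /-- (V) vertical pullbacks; in a preorder `a ×_c b` is a greatest lower bound of `a, b ≤ c` -/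
  exists_pullback : ∀ {a b c : Ob}, a ≤ c → b ≤ c → ∃ d, IsGLB {a, b} d
  /-- (V) the topology on the vertical category -/
  J : GrothendieckTopology Ob
  /-- every covering family of a polytope contains a polytope -/
  nondegenerate : ∀ {ι : Type u} {x : ι → Ob} {a : Ob},
    IsCoveringFamily J x a → (∀ i, x i = bot) → a = bot
  /-- (H) horizontally a groupoid -/
  hinv : ∀ {a b}, Hor a b → Hor b a
  hinv_comp : ∀ {a b} (σ : Hor a b), hcomp (hinv σ) σ = hid b
  hcomp_inv : ∀ {a b} (σ : Hor a b), hcomp σ (hinv σ) = hid a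
  /-- (P) a horizontal `Σ : a → b` and a vertical `b' ⇢ b` can be completed to a commutative
  square ... -/
  exists_sq : ∀ {a b b'} (σ : Hor a b), b' ≤ b → ∃ (a' : Ob) (τ : Hor a' b'), Sq τ σ
  /-- ... which is unique up to vertical isomorphism: any two completions map to each other ... -/
  sq_unique : ∀ {a b b' a₁ a₂} {σ : Hor a b} {τ₁ : Hor a₁ b'} {τ₂ : Hor a₂ b'},
    Sq τ₁ σ → Sq τ₂ σ → Sq τ₁ τ₂
  /-- ... and whose horizontal filler is unique. -/
  filler_unique : ∀ {a b b' a'} {σ : Hor a b} {τ₁ τ₂ : Hor a' b'},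
    Sq τ₁ σ → Sq τ₂ σ → τ₁ = τ₂
  /-- (P) the resulting `Σ^* : (C_v ↓ b) → (C_v ↓ a)` is well defined on morphisms and fully
  faithful ... -/
  sq_le_iff : ∀ {a b a₁ b₁ a₂ b₂} {σ : Hor a b} {τ₁ : Hor a₁ b₁} {τ₂ : Hor a₂ b₂},
    Sq τ₁ σ → Sq τ₂ σ → (a₁ ≤ a₂ ↔ b₁ ≤ b₂)
  /-- ... and essentially surjective. -/
  sq_surj : ∀ {a b a'} (σ : Hor a b), a' ≤ a →
    ∃ (a'' b' : Ob) (τ : Hor a'' b'), Sq τ σ ∧ a'' ≤ a' ∧ a' ≤ a''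
  /-- (C) covering families are stable under `Σ^*` -/
  cover_pull : ∀ {ι : Type u} {x y : ι → Ob} {a b} (σ : Hor a b) (τ : ∀ i, Hor (y i) (x i)),
    (∀ i, Sq (τ i) σ) → IsCoveringFamily J x b → IsCoveringFamily J y a
  /-- (B) -/
  cover_refine : ∀ {ι : Type u} {κ : ι → Type u} {x : ι → Ob} {y : ∀ i, κ i → Ob} {a : Ob},
    (∀ i, x i ≤ a) → (∀ i, IsCoveringFamily J (y i) (x i)) →
    IsCoveringFamily J (fun z : (Σ i, κ i) => y z.1 z.2) a → IsCoveringFamily J x a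

namespace PolytopeComplex

variable (C : PolytopeComplex.{v, u})

/-- A polytope is a noninitial object. -/
def Polytope : Type u := {a : C.Ob // a ≠ C.bot}

end PolytopeComplex

/-- A polytope functor: a double functor which vertically preserves the initial object, pullbacks
and covering families.  Commutative squares being preserved, and all of them being pullback
squares, `F (Σ^* P) ≅ F (Σ)^* F (P)`. -/
@[ext]
structure PolytopeFunctor (C D : PolytopeComplex.{v, u}) where
  obj : C.Ob → D.Ob
  mono : ∀ {a b}, a ≤ b → obj a ≤ obj b
  hmap : ∀ {a b}, C.Hor a b → D.Hor (obj a) (obj b)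
  hmap_id : ∀ a, hmap (C.hid a) = D.hid (obj a)
  hmap_comp : ∀ {a b c} (σ : C.Hor a b) (τ : C.Hor b c),
    hmap (C.hcomp σ τ) = D.hcomp (hmap σ) (hmap τ)
  sq : ∀ {a b c d} {σ : C.Hor a b} {τ : C.Hor c d}, C.Sq σ τ → D.Sq (hmap σ) (hmap τ)
  map_bot : obj C.bot = D.bot
  map_pullback : ∀ {a b c d : C.Ob}, a ≤ c → b ≤ c → IsGLB {a, b} d →
    IsGLB {obj a, obj b} (obj d)
  map_cover : ∀ {ι : Type u} {x : ι → C.Ob} {a : C.Ob},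
    IsCoveringFamily C.J x a → IsCoveringFamily D.J (fun i => obj (x i)) (obj a)

/-- The category of polytope complexes and polytope functors. -/
instance : Category PolytopeComplex.{v, u} where
  Hom := PolytopeFunctor
  id C :=
    { obj := fun a => a, mono := fun h => h, hmap := fun σ => σ, hmap_id := fun _ => rfl,
      hmap_comp := fun _ _ => rfl, sq := fun h => h, map_bot := rfl,
      map_pullback := fun _ _ h => h, map_cover := fun h => h }
  comp F G :=
    { obj := fun a => G.obj (F.obj a)
      mono := fun h => G.mono (F.mono h)
      hmap := fun σ => G.hmap (F.hmap σ)
      hmap_id := fun a => by rw [F.hmap_id, G.hmap_id]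
      hmap_comp := fun σ τ => by rw [F.hmap_comp, G.hmap_comp]
      sq := fun h => G.sq (F.sq h)
      map_bot := by rw [F.map_bot, G.map_bot]
      map_pullback := fun ha hb h => G.map_pullback (F.mono ha) (F.mono hb)
        (F.map_pullback ha hb h)
      map_cover := fun h => G.map_cover (F.map_cover h) }

namespace PolytopeComplex

variable {C : PolytopeComplex.{v, u}}

theorem isGLB_bot_iff {a b : C.Ob} :
    IsGLB {a, b} C.bot ↔ ∀ c, c ≤ a → c ≤ b → c = C.bot := by
  constructor
  · intro h c ha hb
    refine C.eq_bot (h.2 ?_)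
    rintro x (rfl | rfl) <;> assumption
  · intro h
    refine ⟨fun x _ => C.bot_le x, fun c hc => ?_⟩
    rw [h c (hc (by simp)) (hc (by simp))]

/-- Pulling back along a fixed horizontal morphism is monotone, compatibly with the fillers. -/
theorem sq_mono {a b a₁ b₁ a₂ b₂ : C.Ob} {σ : C.Hor a b} {τ₁ : C.Hor a₁ b₁} {τ₂ : C.Hor a₂ b₂}
    (h₁ : C.Sq τ₁ σ) (h₂ : C.Sq τ₂ σ) (h : b₁ ≤ b₂) : C.Sq τ₁ τ₂ := by
  obtain ⟨x, ρ, hρ⟩ := C.exists_sq τ₂ h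
  exact C.sq_vcomp (C.sq_unique h₁ (C.sq_vcomp hρ h₂)) hρ

theorem sq_symm {a b c d : C.Ob} {σ : C.Hor a b} {τ : C.Hor c d}
    (h : C.Sq σ τ) (hd : d ≤ b) : C.Sq τ σ :=
  sq_mono (C.sq_vid τ) h hd

theorem left_eq_bot {a b : C.Ob} (σ : C.Hor a b) (hb : b = C.bot) : a = C.bot := by
  obtain ⟨a'', b', τ, hτ, h, -⟩ := C.sq_surj σ (C.bot_le a)
  have h1 : b' = C.bot := C.eq_bot (hb ▸ C.sq_right hτ)
  have : a ≤ a'' := (C.sq_le_iff (C.sq_vid σ) hτ).2 (by rw [hb]; exact C.bot_le _)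
  exact C.eq_bot (this.trans h)

theorem ne_bot_of_le {a b : C.Ob} (h : a ≤ b) (ha : a ≠ C.bot) : b ≠ C.bot := fun hb =>
  ha (C.eq_bot (hb ▸ h))

theorem eq_bot_iff {a b : C.Ob} (σ : C.Hor a b) : a = C.bot ↔ b = C.bot :=
  ⟨left_eq_bot (C.hinv σ), left_eq_bot σ⟩

theorem disjoint_of_sq {a b a₁ b₁ a₂ b₂ : C.Ob} {σ : C.Hor a b} {τ₁ : C.Hor a₁ b₁}
    {τ₂ : C.Hor a₂ b₂} (h₁ : C.Sq τ₁ σ) (h₂ : C.Sq τ₂ σ) (h : IsGLB {b₁, b₂} C.bot) :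
    IsGLB {a₁, a₂} C.bot := by
  rw [isGLB_bot_iff] at h ⊢
  intro c hc₁ hc₂
  obtain ⟨a'', b', τ, hτ, h3, h4⟩ := C.sq_surj σ (hc₁.trans (C.sq_left h₁))
  have := h b' ((C.sq_le_iff hτ h₁).1 (h3.trans hc₁)) ((C.sq_le_iff hτ h₂).1 (h3.trans hc₂))
  have h5 := left_eq_bot τ this
  exact C.eq_bot (h5 ▸ h4)

/-! ### Sub-maps between families -/

/-- The set map `p`, together with the vertical morphisms `x i ⇢ y (p i)`, is a sub-map from the
family `x` to the family `y`. -/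
structure IsSubmap {I : Type*} {K : Type*} (x : I → C.Ob) (y : K → C.Ob) (p : I → K) : Prop where
  le : ∀ i, x i ≤ y (p i)
  disjoint : ∀ i i', i ≠ i' → p i = p i' → IsGLB {x i, x i'} C.bot

/-- A covering sub-map. -/
structure IsCoveringSubmap {I : Type*} {K : Type*} (x : I → C.Ob) (y : K → C.Ob) (p : I → K) :
    Prop extends IsSubmap x y p where
  cover : ∀ k, IsCoveringFamily C.J (fun i : {i // p i = k} => x i.1) (y k)

end PolytopeComplex

/-! ## The category `SC(C)` -/

/-- An object `{a_i}_{i ∈ I}`: a finite family of polytopes.  The index set `I` is a finite set of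
natural numbers, and the family is extended by the initial object outside `I`, so that
`I = {n | a_n ≠ ∅}`. -/
@[ext]
structure SC (C : PolytopeComplex.{v, u}) where
  val : ℕ → C.Ob
  finite : {n | val n ≠ C.bot}.Finite

namespace SC

open PolytopeComplex

variable {C : PolytopeComplex.{v, u}}

/-- The index set of the family. -/
def Idx (A : SC C) : Type := {n : ℕ // A.val n ≠ C.bot}

/-- The polytopes of the family. -/
def elt (A : SC C) (i : A.Idx) : C.Ob := A.val i.1

instance (A : SC C) : Finite A.Idx := A.finite

theorem Idx.transfer {D : PolytopeComplex.{v, u}} {A : SC C} {B : SC D} {i j : A.Idx}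
    {i' j' : B.Idx} (h : i = j) (hi : i'.1 = i.1) (hj : j'.1 = j.1) : i' = j' :=
  Subtype.ext (hi.trans ((congrArg Subtype.val h).trans hj.symm))

/-- A diagram `A ⇠p A' →σ B`: a sub-map `p` and a shuffle `σ` (a set map `f` together with
horizontal morphisms `a'_i → b_{f i}`). -/
structure Span (A B : SC C) where
  apex : SC C
  p : apex.Idx → A.Idx
  sub : IsSubmap apex.elt A.elt p
  f : apex.Idx → B.Idx
  hor : ∀ i, C.Hor (apex.elt i) (B.elt (f i))

/-- Two diagrams are equivalent if there is a vertical isomorphism `ι` of their apices (a bijection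
of index sets and vertical isomorphisms of the components) compatible with both legs. -/
def Span.Equiv {A B : SC C} (S T : Span A B) : Prop :=
  ∃ ι : S.apex.Idx ≃ T.apex.Idx, ∀ i,
    (S.apex.elt i ≤ T.apex.elt (ι i) ∧ T.apex.elt (ι i) ≤ S.apex.elt i) ∧
    T.p (ι i) = S.p i ∧ T.f (ι i) = S.f i ∧ C.Sq (S.hor i) (T.hor (ι i))

theorem Span.Equiv.refl {A B : SC C} (S : Span A B) : S.Equiv S :=
  ⟨_root_.Equiv.refl _, fun _ => ⟨⟨le_rfl, le_rfl⟩, rfl, rfl, C.sq_vid _⟩⟩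

theorem Span.Equiv.symm {A B : SC C} {S T : Span A B} (h : S.Equiv T) : T.Equiv S := by
  obtain ⟨ι, h⟩ := h
  refine ⟨ι.symm, fun i => ?_⟩
  obtain ⟨i, rfl⟩ := ι.surjective i
  obtain ⟨⟨h1, h2⟩, h3, h4, h5⟩ := h i
  rw [ι.symm_apply_apply]
  exact ⟨⟨h2, h1⟩, h3.symm, h4.symm, sq_symm h5 (by rw [h4])⟩

theorem Span.Equiv.trans {A B : SC C} {S T U : Span A B} (h : S.Equiv T) (h' : T.Equiv U) :
    S.Equiv U := by
  obtain ⟨ι, h⟩ := h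
  obtain ⟨ι', h'⟩ := h'
  refine ⟨ι.trans ι', fun i => ?_⟩
  obtain ⟨⟨h1, h2⟩, h3, h4, h5⟩ := h i
  obtain ⟨⟨k1, k2⟩, k3, k4, k5⟩ := h' (ι i)
  exact ⟨⟨h1.trans k1, k2.trans h2⟩, k3.trans h3, k4.trans h4, C.sq_vcomp h5 k5⟩

instance Span.setoid (A B : SC C) : Setoid (Span A B) :=
  ⟨Span.Equiv, Span.Equiv.refl, Span.Equiv.symm, Span.Equiv.trans⟩

/-- The identity diagram. -/
def Span.id (A : SC C) : Span A A where
  apex := A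
  p i := i
  sub := ⟨fun _ => le_rfl, fun _ _ h h' => absurd h' h⟩
  f i := i
  hor _ := C.hid _

section Pull

/-- A chosen pullback `Σ^* b'`. -/
noncomputable def pull {a b b' : C.Ob} (σ : C.Hor a b) (h : b' ≤ b) : C.Ob :=
  (C.exists_sq σ h).choose

/-- The horizontal morphism `Σ^* b' → b'`. -/
noncomputable def pullHor {a b b' : C.Ob} (σ : C.Hor a b) (h : b' ≤ b) : C.Hor (pull σ h) b' :=
  (C.exists_sq σ h).choose_spec.choose

theorem pull_sq {a b b' : C.Ob} (σ : C.Hor a b) (h : b' ≤ b) : C.Sq (pullHor σ h) σ :=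
  (C.exists_sq σ h).choose_spec.choose_spec

end Pull

section OfFamily

variable {I : Type} [Finite I] (x : I → C.Ob) (hx : ∀ i, x i ≠ C.bot) (e : I ↪ ℕ)

open Classical in
/-- The object with components `x i`, the index `i` being renamed to `e i`. -/
noncomputable def ofFamily : SC C where
  val n := if h : ∃ i, e i = n then x h.choose else C.bot
  finite := by
    refine (Set.finite_range e).subset fun n hn => ?_
    by_contra h
    exact hn (dif_neg h)

theorem ofFamily_val (i : I) : (ofFamily x e).val (e i) = x i := by
  have h : ∃ j, e j = e i := ⟨i, rfl⟩
  have h2 : h.choose = i := e.injective h.choose_spec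
  unfold ofFamily
  simp only
  rw [dif_pos h, h2]

/-- The index set of `ofFamily x e` is a copy of `I`. -/
noncomputable def ofFamilyEquiv : (ofFamily x e).Idx ≃ I :=
  (_root_.Equiv.ofBijective
    (fun i : I => (⟨e i, by rw [ofFamily_val]; exact hx i⟩ : (ofFamily x e).Idx))
    ⟨fun i j h => e.injective (congrArg Subtype.val h), fun n => by
      by_cases h : ∃ i, e i = n.1
      · obtain ⟨i, hi⟩ := h
        exact ⟨i, Subtype.ext hi⟩
      · exact absurd (dif_neg h) n.2⟩).symm

theorem ofFamily_elt (i : (ofFamily x e).Idx) :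
    (ofFamily x e).elt i = x (ofFamilyEquiv x hx e i) := by
  obtain ⟨i, rfl⟩ := (ofFamilyEquiv x hx e).symm.surjective i
  rw [_root_.Equiv.apply_symm_apply]
  exact ofFamily_val x e i

end OfFamily

section Comp

variable {A B D : SC C} (S : Span A B) (T : Span B D)

/-- The index set `I' ×_J J'` of the pullback `σ^* B'`. -/
abbrev CompIdx : Type := {z : S.apex.Idx × T.apex.Idx // S.f z.1 = T.p z.2}

theorem compIdx_le (z : CompIdx S T) : T.apex.elt z.1.2 ≤ B.elt (S.f z.1.1) := by
  rw [z.2]; exact T.sub.le _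

/-- The components `Σ_i^* b'_j` of the pullback `σ^* B'`. -/
noncomputable def compFam (z : CompIdx S T) : C.Ob :=
  pull (S.hor z.1.1) (compIdx_le S T z)

/-- The horizontal components of `σ^* B' → B'`. -/
noncomputable def compHor (z : CompIdx S T) : C.Hor (compFam S T z) (T.apex.elt z.1.2) :=
  pullHor (S.hor z.1.1) (compIdx_le S T z)

theorem compHor_sq (z : CompIdx S T) : C.Sq (compHor S T z) (S.hor z.1.1) :=
  pull_sq _ _

theorem compFam_ne (z : CompIdx S T) : compFam S T z ≠ C.bot := fun h =>
  z.1.2.2 ((eq_bot_iff (compHor S T z)).1 h)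

/-- Names for the indices of the pullback. -/
def compCode : CompIdx S T ↪ ℕ where
  toFun z := Nat.pair z.1.1.1 z.1.2.1
  inj' z z' h := by
    have h' := Nat.pair_eq_pair.1 h
    exact Subtype.ext (Prod.ext (Subtype.ext h'.1) (Subtype.ext h'.2))

theorem compFam_submap :
    IsSubmap (compFam S T) A.elt (fun z => S.p z.1.1) where
  le z := (C.sq_left (compHor_sq S T z)).trans (S.sub.le _)
  disjoint := by
    rintro ⟨⟨s, t⟩, hz⟩ ⟨⟨s', t'⟩, hz'⟩ hne hp
    by_cases hs : s = s'
    · subst hs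
      have ht : t ≠ t' := by rintro rfl; exact hne rfl
      exact disjoint_of_sq (compHor_sq S T ⟨⟨s, t⟩, hz⟩) (compHor_sq S T ⟨⟨s, t'⟩, hz'⟩)
        (T.sub.disjoint t t' ht (hz.symm.trans hz'))
    · have := S.sub.disjoint s s' hs hp
      rw [isGLB_bot_iff] at this ⊢
      exact fun c h h' => this c (h.trans (C.sq_left (compHor_sq S T ⟨⟨s, t⟩, hz⟩)))
        (h'.trans (C.sq_left (compHor_sq S T ⟨⟨s', t'⟩, hz'⟩)))

/-- The composite diagram `A ⇠ A' ⇠ σ^* B' → B' → D`. -/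
noncomputable def Span.comp : Span A D where
  apex := ofFamily (compFam S T) (compCode S T)
  p i := S.p (ofFamilyEquiv _ (compFam_ne S T) _ i).1.1
  sub :=
    { le := fun i => by
        rw [ofFamily_elt _ (compFam_ne S T)]
        exact (compFam_submap S T).le _
      disjoint := fun i i' h h' => by
        rw [ofFamily_elt _ (compFam_ne S T), ofFamily_elt _ (compFam_ne S T)]
        exact (compFam_submap S T).disjoint _ _
          (fun h'' => h ((ofFamilyEquiv _ (compFam_ne S T) _).injective h'')) h' }
  f i := T.f (ofFamilyEquiv _ (compFam_ne S T) _ i).1.2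
  hor i := cast (by rw [ofFamily_elt _ (compFam_ne S T)])
    (C.hcomp (compHor S T (ofFamilyEquiv _ (compFam_ne S T) _ i)) (T.hor _))

/-- `U` is a composite of `S` and `T`, for some choice of the pullback. -/
def Span.IsComp (U : Span A D) : Prop :=
  ∃ e : U.apex.Idx ≃ CompIdx S T, ∀ i,
    U.p i = S.p (e i).1.1 ∧ U.f i = T.f (e i).1.2 ∧
    ∃ κ : C.Hor (U.apex.elt i) (T.apex.elt (e i).1.2),
      C.Sq κ (S.hor (e i).1.1) ∧ C.Sq (U.hor i) (C.hcomp κ (T.hor (e i).1.2))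

theorem exists_cast_sq {a a' b b' d : C.Ob} (h : a = a') (κ : C.Hor a' b) (τ : C.Hor b d)
    {c : C.Ob} (σ : C.Hor c b') (hs : C.Sq κ σ) (h' : C.Hor a' d = C.Hor a d) :
    ∃ κ' : C.Hor a b, C.Sq κ' σ ∧ C.Sq (cast h' (C.hcomp κ τ)) (C.hcomp κ' τ) := by
  subst h
  exact ⟨κ, hs, C.sq_vid _⟩

theorem Span.comp_isComp : Span.IsComp S T (Span.comp S T) :=
  ⟨ofFamilyEquiv _ (compFam_ne S T) _, fun _ => ⟨rfl, rfl,
    exists_cast_sq (ofFamily_elt _ (compFam_ne S T) _ _) _ _ _ (compHor_sq S T _) _⟩⟩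

variable {S T}

theorem Span.IsComp.equiv {S' : Span A B} {T' : Span B D} {U U' : Span A D}
    (hU : Span.IsComp S T U) (hU' : Span.IsComp S' T' U') (hS : S ≈ S') (hT : T ≈ T') :
    U ≈ U' := by
  obtain ⟨e, he⟩ := hU
  obtain ⟨e', he'⟩ := hU'
  obtain ⟨ι, hι⟩ := hS
  obtain ⟨μ, hμ⟩ := hT
  let g : CompIdx S T ≃ CompIdx S' T' :=
    (ι.prodCongr μ).subtypeEquiv (fun z => by
      simp only [Equiv.prodCongr_apply, Prod.map]
      rw [(hι _).2.2.1, (hμ _).2.1])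
  have key : ∀ i, ∃ i', e' i' = g (e i) ∧ i' = ((e.trans g).trans e'.symm) i :=
    fun i => ⟨_, by simp, rfl⟩
  refine ⟨(e.trans g).trans e'.symm, fun i => ?_⟩
  obtain ⟨i', h1, h2⟩ := key i
  rw [← h2]
  obtain ⟨a1, a2, κ, a3, a4⟩ := he i
  obtain ⟨b1, b2, κ', b3, b4⟩ := he' i'
  have hg1 : (g (e i)).1.1 = ι (e i).1.1 := rfl
  have hg2 : (g (e i)).1.2 = μ (e i).1.2 := rfl
  clear_value g
  generalize e' i' = z at *
  subst h1
  generalize g (e i) = z at *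
  obtain ⟨⟨s, t⟩, hz⟩ := z
  dsimp only at *
  subst hg1 hg2
  obtain ⟨⟨c1, c2⟩, c3, c4, c5⟩ := hι (e i).1.1
  obtain ⟨⟨d1, d2⟩, d3, d4, d5⟩ := hμ (e i).1.2
  have h3 : C.Sq κ κ' := sq_mono (C.sq_vcomp a3 c5) b3 d1
  have h4 : C.Sq κ' κ := sq_symm h3 d2
  have h5 : C.Sq (U'.hor i') (U'.hor i') := C.sq_vid _
  have hf : U'.f i' = U.f i := by rw [b2, a2, d4]
  refine ⟨⟨C.sq_left h3, C.sq_left h4⟩, by rw [b1, a1, c3], hf, ?_⟩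
  have h6 : C.Sq (U.hor i) (C.hcomp κ' (T'.hor (μ (e i).1.2))) :=
    C.sq_vcomp a4 (C.sq_hcomp h3 d5)
  exact C.sq_vcomp h6 (sq_symm b4 (by rw [b2]))

theorem Span.IsComp.assoc {E : SC C} {R : Span D E} {U : Span A D} {V V' : Span A E}
    {W : Span B E} (hU : Span.IsComp S T U) (hV : Span.IsComp U R V) (hW : Span.IsComp T R W)
    (hV' : Span.IsComp S W V') : V ≈ V' := by
  obtain ⟨e, he⟩ := hU
  obtain ⟨d, hd⟩ := hV
  obtain ⟨k, hk⟩ := hW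
  obtain ⟨l, hl⟩ := hV'
  let g : CompIdx U R ≃ CompIdx S W :=
    { toFun := fun z => ⟨((e z.1.1).1.1, k.symm ⟨((e z.1.1).1.2, z.1.2), by
          rw [← (he _).2.1]; exact z.2⟩), by
            rw [(hk _).1, Equiv.apply_symm_apply]; exact (e z.1.1).2⟩
      invFun := fun z => ⟨(e.symm ⟨(z.1.1, (k z.1.2).1.1), by
          rw [← (hk _).1]; exact z.2⟩, (k z.1.2).1.2), by
            rw [(he _).2.1, Equiv.apply_symm_apply]; exact (k z.1.2).2⟩
      left_inv := fun z => by
        obtain ⟨⟨a, b⟩, hz⟩ := z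
        apply Subtype.ext
        apply Prod.ext
        · apply e.injective
          apply Subtype.ext
          simp
        · simp
      right_inv := fun z => by
        obtain ⟨⟨a, b⟩, hz⟩ := z
        apply Subtype.ext
        apply Prod.ext
        · simp
        · apply k.injective
          apply Subtype.ext
          simp }
  have key : ∀ i, ∃ i', l i' = g (d i) ∧ i' = ((d.trans g).trans l.symm) i :=
    fun i => ⟨_, by simp, rfl⟩
  refine ⟨(d.trans g).trans l.symm, fun i => ?_⟩
  obtain ⟨i', h1, h2⟩ := key i
  rw [← h2]
  obtain ⟨a1, a2, κ, a3, a4⟩ := hd i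
  obtain ⟨b1, b2, l', b3, b4⟩ := hl i'
  have hg1 : (g (d i)).1.1 = (e (d i).1.1).1.1 := rfl
  have hg2 : (k (g (d i)).1.2).1 = ((e (d i).1.1).1.2, (d i).1.2) := by simp [g]
  clear_value g
  generalize l i' = z at *
  subst h1
  obtain ⟨c1, c2, κ', c3, c4⟩ := he (d i).1.1
  obtain ⟨d1, d2, μ, d3, d4⟩ := hk (g (d i)).1.2
  generalize g (d i) = z at *
  obtain ⟨⟨s, w⟩, hz⟩ := z
  dsimp only at *
  subst hg1
  generalize k w = y at *
  obtain ⟨⟨t, r⟩, hy⟩ := y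
  obtain ⟨rfl, rfl⟩ := Prod.mk.inj hg2
  dsimp only at *
  have e1 : C.Sq l' κ' := sq_mono b3 c3 (C.sq_left d3)
  have e2 : C.Sq (C.hcomp l' μ) (C.hcomp κ' (T.hor (e (d i).1.1).1.2)) := C.sq_hcomp e1 d3
  have e3 : C.Sq κ (C.hcomp κ' (T.hor (e (d i).1.1).1.2)) := C.sq_vcomp a3 c4
  have e4 : C.Sq κ (C.hcomp l' μ) := C.sq_unique e3 e2
  have e5 : C.Sq (C.hcomp l' μ) κ := C.sq_unique e2 e3
  refine ⟨⟨C.sq_left e4, C.sq_left e5⟩, by rw [b1, a1, c1], by rw [b2, a2, d2], ?_⟩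
  have e6 : C.Sq (V.hor i) (C.hcomp (C.hcomp l' μ) (R.hor (d i).1.2)) :=
    C.sq_vcomp a4 (C.sq_hcomp e4 (C.sq_vid _))
  rw [C.hassoc] at e6
  have e7 : C.Sq (C.hcomp μ (R.hor (d i).1.2)) (W.hor w) := sq_symm d4 (by rw [d2])
  exact C.sq_vcomp (C.sq_vcomp e6 (C.sq_hcomp (C.sq_vid l') e7)) (sq_symm b4 (by rw [b2]))

theorem Span.id_isComp (T : Span A B) : Span.IsComp (Span.id A) T T :=
  ⟨{ toFun := fun i => ⟨(T.p i, i), rfl⟩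
     invFun := fun z => z.1.2
     left_inv := fun _ => rfl
     right_inv := fun z => Subtype.ext (Prod.ext z.2.symm rfl) }, fun i =>
    ⟨rfl, rfl, C.hid _, C.sq_hid (T.sub.le i), by rw [C.hid_comp]; exact C.sq_vid _⟩⟩

theorem Span.isComp_id (S : Span A B) : Span.IsComp S (Span.id B) S :=
  ⟨{ toFun := fun i => ⟨(i, S.f i), rfl⟩
     invFun := fun z => z.1.1
     left_inv := fun _ => rfl
     right_inv := fun z => Subtype.ext (Prod.ext rfl z.2) }, fun i =>
    ⟨rfl, rfl, S.hor i, C.sq_vid _, by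
      have := C.hcomp_id (S.hor i)
      exact this.symm ▸ C.sq_vid _⟩⟩

end Comp

/-- The category `SC(C)`. -/
noncomputable instance : Category (SC C) where
  Hom A B := Quotient (Span.setoid A B)
  id A := Quotient.mk _ (Span.id A)
  comp := Quotient.map₂ Span.comp fun S S' hS T T' hT =>
    (Span.comp_isComp S T).equiv (Span.comp_isComp S' T') hS hT
  id_comp f := Quotient.inductionOn f fun T => Quotient.sound
    ((Span.comp_isComp _ T).equiv (Span.id_isComp T) (Setoid.refl _) (Setoid.refl _))
  comp_id f := Quotient.inductionOn f fun T => Quotient.sound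
    ((Span.comp_isComp T _).equiv (Span.isComp_id T) (Setoid.refl _) (Setoid.refl _))
  assoc f g h := Quotient.inductionOn₃ f g h fun S T R => Quotient.sound
    (Span.IsComp.assoc (Span.comp_isComp S T) (Span.comp_isComp _ R) (Span.comp_isComp T R)
      (Span.comp_isComp S _))

/-- The morphism represented by a diagram. -/
def Span.hom {A B : SC C} (S : Span A B) : A ⟶ B := Quotient.mk _ S

theorem Span.hom_comp {A B D : SC C} {S : Span A B} {T : Span B D} {U : Span A D}
    (h : Span.IsComp S T U) : S.hom ≫ T.hom = U.hom :=
  Quotient.sound ((Span.comp_isComp S T).equiv h (Setoid.refl _) (Setoid.refl _))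

/-- Cofibrations: `p` is a covering sub-map and `σ` has an injective set map. -/
def cof (C : PolytopeComplex.{v, u}) : MorphismProperty (SC C) := fun A B φ =>
  ∃ S : Span A B, S.hom = φ ∧ IsCoveringSubmap S.apex.elt A.elt S.p ∧ Function.Injective S.f

/-- Weak equivalences: `p` is a covering sub-map and `σ` has a bijective set map. -/
def weq (C : PolytopeComplex.{v, u}) : MorphismProperty (SC C) := fun A B φ =>
  ∃ S : Span A B, S.hom = φ ∧ IsCoveringSubmap S.apex.elt A.elt S.p ∧ Function.Bijective S.f

/-- The object `{a}` with a single polytope `a` (indexed by `0`). -/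
noncomputable def single (a : C.Polytope) : SC C where
  val n := if n = 0 then a.1 else C.bot
  finite := (Set.finite_singleton 0).subset fun n hn => by
    by_contra h
    exact hn (if_neg h)

/-! ### Functoriality -/

section Map

variable {D E : PolytopeComplex.{v, u}} (F : C ⟶ D)

/-- `{a_i}_i ↦ {F a_i}_i`; indices with `F a_i` initial disappear from the index set. -/
def mapObj (A : SC C) : SC D where
  val n := F.obj (A.val n)
  finite := A.finite.subset fun n hn h => hn (by rw [h, F.map_bot])

/-- The inclusion of index sets. -/
def idxIncl (A : SC C) (i : (mapObj F A).Idx) : A.Idx :=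
  ⟨i.1, fun h => i.2 (by
    have : F.obj (A.val i.1) = D.bot := by rw [h, F.map_bot]
    exact this)⟩

theorem idxIncl_injective (A : SC C) : Function.Injective (idxIncl F A) := fun _ _ h =>
  Idx.transfer h rfl rfl

/-- The image of a diagram. -/
def mapSpan {A B : SC C} (S : Span A B) : Span (mapObj F A) (mapObj F B) where
  apex := mapObj F S.apex
  p i := ⟨(S.p (idxIncl F _ i)).1, fun h =>
    ne_bot_of_le (F.mono (S.sub.le (idxIncl F _ i))) i.2 h⟩
  sub :=
    { le := fun i => F.mono (S.sub.le (idxIncl F _ i))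
      disjoint := fun i i' h h' => by
        have h1 : S.p (idxIncl F _ i) = S.p (idxIncl F _ i') :=
          Idx.transfer h' rfl rfl
        have h2 := S.sub.disjoint _ _ (fun h'' => h (idxIncl_injective F _ h'')) h1
        have h3 := F.map_pullback (S.sub.le _) (by rw [h1]; exact S.sub.le _) h2
        rw [F.map_bot] at h3
        exact h3 }
  f i := ⟨(S.f (idxIncl F _ i)).1, fun h =>
    i.2 ((eq_bot_iff (F.hmap (S.hor (idxIncl F _ i)))).2 h)⟩
  hor i := F.hmap (S.hor (idxIncl F _ i))

theorem mapSpan_equiv {A B : SC C} {S T : Span A B} (h : S ≈ T) : mapSpan F S ≈ mapSpan F T := by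
  obtain ⟨ι, h⟩ := h
  let g : (mapObj F S.apex).Idx ≃ (mapObj F T.apex).Idx :=
    { toFun := fun i => ⟨(ι (idxIncl F _ i)).1, fun hb =>
        ne_bot_of_le (F.mono (h (idxIncl F _ i)).1.1) i.2 hb⟩
      invFun := fun i => ⟨(ι.symm (idxIncl F _ i)).1, fun hb => by
        have := (h (ι.symm (idxIncl F _ i))).1.2
        rw [Equiv.apply_symm_apply] at this
        exact ne_bot_of_le (F.mono this) i.2 hb⟩
      left_inv := fun i => by
        apply idxIncl_injective
        exact ι.symm_apply_apply _
      right_inv := fun i => by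
        apply idxIncl_injective
        exact ι.apply_symm_apply _ }
  refine ⟨g, fun i => ?_⟩
  obtain ⟨⟨h1, h2⟩, h3, h4, h5⟩ := h (idxIncl F _ i)
  exact ⟨⟨F.mono h1, F.mono h2⟩, Idx.transfer h3 rfl rfl,
    Idx.transfer h4 rfl rfl, F.sq h5⟩

theorem mapSpan_isComp {A B K : SC C} {S : Span A B} {T : Span B K} {U : Span A K}
    (h : Span.IsComp S T U) : Span.IsComp (mapSpan F S) (mapSpan F T) (mapSpan F U) := by
  obtain ⟨e, he⟩ := h
  let g : (mapSpan F U).apex.Idx ≃ CompIdx (mapSpan F S) (mapSpan F T) :=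
    { toFun := fun i => ⟨(⟨(e (idxIncl F _ i)).1.1.1, fun hb => by
          obtain ⟨-, -, κ, h1, -⟩ := he (idxIncl F _ i)
          exact ne_bot_of_le (F.mono (C.sq_left h1)) i.2 hb⟩,
          ⟨(e (idxIncl F _ i)).1.2.1, fun hb => by
          obtain ⟨-, -, κ, h1, -⟩ := he (idxIncl F _ i)
          exact i.2 ((eq_bot_iff (F.hmap κ)).2 hb)⟩),
          Idx.transfer (e (idxIncl F _ i)).2 rfl rfl⟩
      invFun := fun z => ⟨(e.symm ⟨(idxIncl F _ z.1.1, idxIncl F _ z.1.2),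
          Idx.transfer z.2 rfl rfl⟩).1, fun hb => by
          obtain ⟨-, -, κ, h1, -⟩ := he (e.symm ⟨(idxIncl F _ z.1.1, idxIncl F _ z.1.2),
            Idx.transfer z.2 rfl rfl⟩)
          have := (eq_bot_iff (F.hmap κ)).1 hb
          rw [Equiv.apply_symm_apply] at this
          exact z.1.2.2 this⟩
      left_inv := fun i => by
        apply idxIncl_injective
        exact e.symm_apply_apply _
      right_inv := fun z => by
        have key := e.apply_symm_apply ⟨(idxIncl F _ z.1.1, idxIncl F _ z.1.2),
            Idx.transfer z.2 rfl rfl⟩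
        apply Subtype.ext
        apply Prod.ext
        · apply idxIncl_injective
          exact congrArg (fun y => y.1.1) key
        · apply idxIncl_injective
          exact congrArg (fun y => y.1.2) key }
  refine ⟨g, fun i => ?_⟩
  obtain ⟨h1, h2, κ, h3, h4⟩ := he (idxIncl F _ i)
  refine ⟨Idx.transfer h1 rfl rfl, Idx.transfer h2 rfl rfl,
    F.hmap κ, F.sq h3, ?_⟩
  have := F.sq h4
  rw [F.hmap_comp] at this
  exact this

/-- The functor `SC(F) : SC(C) ⥤ SC(D)` induced by a polytope functor `F`. -/
def map : SC C ⥤ SC D where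
  obj := mapObj F
  map := Quotient.map (mapSpan F) fun _ _ => mapSpan_equiv F
  map_id A := Quotient.sound ⟨_root_.Equiv.refl _, fun i =>
    ⟨⟨le_rfl, le_rfl⟩, rfl, rfl, by
      have h := F.hmap_id (A.elt (idxIncl F A i))
      change D.Sq (F.hmap (C.hid (A.elt (idxIncl F A i)))) _
      rw [h]
      exact D.sq_vid _⟩⟩
  map_comp f g := Quotient.inductionOn₂ f g fun S T =>
    (Span.hom_comp (mapSpan_isComp F (Span.comp_isComp S T))).symm

theorem map_id (C : PolytopeComplex.{v, u}) : map (𝟙 C) = 𝟭 (SC C) :=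
  CategoryTheory.Functor.hext (fun _ => rfl) fun _ _ f =>
    heq_of_eq (Quotient.inductionOn f fun _ => rfl)

theorem map_comp (G : D ⟶ E) : map (F ≫ G) = map F ⋙ map G :=
  CategoryTheory.Functor.hext (fun _ => rfl) fun _ _ f =>
    heq_of_eq (Quotient.inductionOn f fun _ => rfl)

end Map

end SC

/-! ## Waldhausen categories -/

section Waldhausen

variable {E : Type u'} [Category.{v'} E]

/-- `E`, with cofibrations `co` and weak equivalences `w`, is a Waldhausen category. -/
structure IsWaldhausen (co w : MorphismProperty E) : Prop where
  hasZero : HasZeroObject E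
  co_mul : co.IsMultiplicative
  w_mul : w.IsMultiplicative
  co_of_iso : ∀ {A B : E} (f : A ⟶ B), IsIso f → co f
  w_of_iso : ∀ {A B : E} (f : A ⟶ B), IsIso f → w f
  co_of_zero : ∀ {Z A : E} (f : Z ⟶ A), IsZero Z → co f
  hasPushout : ∀ {A B X : E} (i : A ⟶ B) (f : A ⟶ X), co i → HasPushout i f
  co_pushout : ∀ {A B X P : E} {i : A ⟶ B} {f : A ⟶ X} {g : B ⟶ P} {j : X ⟶ P},
    IsPushout i f g j → co i → co j
  gluing : ∀ {A B X P A' B' X' P' : E} {i : A ⟶ B} {f : A ⟶ X} {g : B ⟶ P} {j : X ⟶ P}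
    {i' : A' ⟶ B'} {f' : A' ⟶ X'} {g' : B' ⟶ P'} {j' : X' ⟶ P'}
    {a : A ⟶ A'} {b : B ⟶ B'} {x : X ⟶ X'} {t : P ⟶ P'},
    IsPushout i f g j → IsPushout i' f' g' j' → co i → co i' →
    i ≫ b = a ≫ i' → f ≫ x = a ≫ f' → g ≫ t = b ≫ g' → j ≫ t = x ≫ j' →
    w a → w b → w x → w t

/-- `A → B → Q` is a cofibration sequence: `i` is a cofibration and `q` is its cofiber, the pushout
of `i` along `A → 0`. -/
structure IsCofibrationSequence (co : MorphismProperty E) {A B Q : E} (i : A ⟶ B) (q : B ⟶ Q) :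
    Prop where
  co : co i
  cofiber : ∃ (Z : E) (f : A ⟶ Z) (g : Z ⟶ Q), IsZero Z ∧ IsPushout i f q g

/-- The extension axiom. -/
def ExtensionAxiom (co w : MorphismProperty E) : Prop :=
  ∀ {A B Q A' B' Q' : E} {i : A ⟶ B} {q : B ⟶ Q} {i' : A' ⟶ B'} {q' : B' ⟶ Q'}
    {a : A ⟶ A'} {b : B ⟶ B'} {c : Q ⟶ Q'},
    IsCofibrationSequence co i q → IsCofibrationSequence co i' q' →
    i ≫ b = a ≫ i' → q ≫ c = b ≫ q' → w a → w c → w b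

/-- Every cofibration sequence `A → B → Q` has a canonical splitting: there is exactly one section
`s` of `B → Q`; it is a cofibration, and `A ⨿ Q → B` is a weak equivalence. -/
def HasCanonicalSplittings (co w : MorphismProperty E) : Prop :=
  ∀ {A B Q : E} {i : A ⟶ B} {q : B ⟶ Q}, IsCofibrationSequence co i q →
    ∃ s : Q ⟶ B, s ≫ q = 𝟙 Q ∧ (∀ s' : Q ⟶ B, s' ≫ q = 𝟙 Q → s' = s) ∧ co s ∧
      ∀ (c : BinaryCofan A Q) (hc : IsColimit c), w (BinaryCofan.IsColimit.desc hc i s)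

/-- The relations defining `K₀` of a Waldhausen category. -/
inductive K0Rel (co w : MorphismProperty E) : FreeAbelianGroup E → Prop
  | weq {A B : E} (f : A ⟶ B) (hf : w f) :
      K0Rel co w (FreeAbelianGroup.of A - FreeAbelianGroup.of B)
  | cof {A B Q : E} (i : A ⟶ B) (q : B ⟶ Q) (h : IsCofibrationSequence co i q) :
      K0Rel co w (FreeAbelianGroup.of B - (FreeAbelianGroup.of A + FreeAbelianGroup.of Q))

/-- `K₀` of a Waldhausen category: the free abelian group on the objects, modulo `[A] = [B]` for
weak equivalences `A → B` and `[B] = [A] + [B/A]` for cofibration sequences `A → B → B/A`. -/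
abbrev K0 (co w : MorphismProperty E) : Type u' :=
  FreeAbelianGroup E ⧸ AddSubgroup.closure {x | K0Rel co w x}

/-- The class of an object in `K₀`. -/
def K0.of (co w : MorphismProperty E) (A : E) : K0 co w :=
  QuotientAddGroup.mk (FreeAbelianGroup.of A)

/-- Exact functors between Waldhausen categories. -/
structure IsExactFunctor {E' : Type*} [Category* E'] (co w : MorphismProperty E)
    (co' w' : MorphismProperty E') (F : E ⥤ E') : Prop where
  map_zero : ∀ {Z : E}, IsZero Z → IsZero (F.obj Z)
  map_co : ∀ {A B : E} (f : A ⟶ B), co f → co' (F.map f)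
  map_w : ∀ {A B : E} (f : A ⟶ B), w f → w' (F.map f)
  map_pushout : ∀ {A B X P : E} {i : A ⟶ B} {f : A ⟶ X} {g : B ⟶ P} {j : X ⟶ P},
    IsPushout i f g j → co i → IsPushout (F.map i) (F.map f) (F.map g) (F.map j)

end Waldhausen

/-- A category with two distinguished classes of morphisms. -/
structure MarkedCat where
  carrier : Type u'
  [cat : Category.{v'} carrier]
  co : MorphismProperty carrier
  w : MorphismProperty carrier

attribute [instance] MarkedCat.cat

/-- Morphisms of `MarkedCat` are all functors. -/
instance : Category MarkedCat.{v', u'} where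
  Hom X Y := X.carrier ⥤ Y.carrier
  id X := 𝟭 X.carrier
  comp F G := F ⋙ G

/-- A Waldhausen category. -/
structure WaldCat extends MarkedCat.{v', u'} where
  isWaldhausen : IsWaldhausen co w

/-- The category of Waldhausen categories and exact functors. -/
instance : Category WaldCat.{v', u'} where
  Hom X Y := {F : X.carrier ⥤ Y.carrier // IsExactFunctor X.co X.w Y.co Y.w F}
  id X := ⟨𝟭 X.carrier, ⟨fun h => h, fun _ h => h, fun _ h => h, fun h _ => h⟩⟩
  comp F G := ⟨F.1 ⋙ G.1,
    ⟨fun h => G.2.map_zero (F.2.map_zero h), fun _ h => G.2.map_co _ (F.2.map_co _ h),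
      fun _ h => G.2.map_w _ (F.2.map_w _ h),
      fun h hi => G.2.map_pushout (F.2.map_pushout h hi) (F.2.map_co _ hi)⟩⟩

/-- The forgetful functor. -/
def WaldCat.forget : WaldCat.{v', u'} ⥤ MarkedCat.{v', u'} where
  obj X := X.toMarkedCat
  map F := F.1

/-- The assignments `C ↦ SC(C)`, with its cofibrations and weak equivalences, and `F ↦ SC(F)`. -/
noncomputable def SC.functor : PolytopeComplex.{v, u} ⥤ MarkedCat.{max u v, u} where
  obj C := { carrier := SC C, co := SC.cof C, w := SC.weq C }
  map F := SC.map F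
  map_id C := SC.map_id C
  map_comp F G := SC.map_comp F G

/-! ## The scissors congruence group -/

open PolytopeComplex in
/-- The relations `[a] = Σ [a_i]` for covering sub-maps `{a_i} ⇢ {a}` and `[a] = [b]` for
horizontal morphisms `a → b`. -/
inductive ScissorsRel (C : PolytopeComplex.{v, u}) : FreeAbelianGroup C.Polytope → Prop
  | cover {I : Type} [Fintype I] (x : I → C.Polytope) (a : C.Polytope)
      (h : IsCoveringSubmap (fun i => (x i).1) (fun _ : Unit => a.1) (fun _ => ())) :
      ScissorsRel C (FreeAbelianGroup.of a - ∑ i, FreeAbelianGroup.of (x i))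
  | hor (a b : C.Polytope) (σ : C.Hor a.1 b.1) :
      ScissorsRel C (FreeAbelianGroup.of a - FreeAbelianGroup.of b)

/-- The free abelian group on the polytopes, modulo the above relations. -/
abbrev ScissorsGroup (C : PolytopeComplex.{v, u}) : Type u :=
  FreeAbelianGroup C.Polytope ⧸ AddSubgroup.closure {x | ScissorsRel C x}

/-- The class of a polytope. -/
def ScissorsGroup.of {C : PolytopeComplex.{v, u}} (a : C.Polytope) : ScissorsGroup C :=
  QuotientAddGroup.mk (FreeAbelianGroup.of a)

namespace PolytopeComplex

variable {C : PolytopeComplex.{v, u}}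

/-! ## Squares and horizontal inverses -/

/-! A morphism of `SC C` is studied through its germs: the restrictions, along commutative squares,
of its components. The germ relation `Rel` does not depend on the representing diagram, determines
the morphism because components over one index are disjoint (`hom_ext`), and is compatible with
composition: germs of a composite are exactly composites of germs (`Rel.comp`, `Rel.of_comp`).
Choices of pullbacks disappear. By `cof_iff` and `weq_iff`, cofibrations are the morphisms that are
total up to a covering and injective, and weak equivalences moreover hit every index. Two out of
three becomes an argument about partial injections, in which nondegeneracy of the topology supplies
polytopes to test on.

The main construction is the pushout of a cofibration A → B along A → X. Keep the members of B
outside the image, and cut each member of X into the pieces on which every component of A → X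
arriving there pulls back into a single component of A → B. These pieces form a finite disjoint
covering, by (C), and the coarsest possible one, which yields the universal property. `PushoutFacts`
records what is invariant under isomorphism and so holds for every pushout; `IsMaximal` records
coarseness. Gluing and the extension axiom follow by treating the indices in the image and those
outside it separately. In a cofiber exactly the members of B outside the image survive, each of them
whole, so inverting the components of the quotient map gives the only section. Pieces are finite
intersections, hence preserved by polytope functors, and this makes `SC.map F` exact.

For K₀, splitting off one member at a time gives [A] = Σ [{aᵢ}]. Conversely Σ [aᵢ] respects the
relations of K₀: weak equivalences decompose into coverings and horizontal morphisms, and the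
canonical section partitions the indices of B in a cofibration sequence. The two homomorphisms are
mutually inverse. -/

theorem hinv_hinv {a b : C.Ob} (σ : C.Hor a b) : C.hinv (C.hinv σ) = σ := by
  rw [← C.hcomp_id (C.hinv (C.hinv σ)), ← C.hinv_comp σ, ← C.hassoc, C.hinv_comp, C.hid_comp]

theorem hcomp_hinv_cancel {a b c : C.Ob} (σ : C.Hor a b) (τ : C.Hor a c) :
    C.hcomp σ (C.hcomp (C.hinv σ) τ) = τ := by
  rw [← C.hassoc, C.hcomp_inv, C.hid_comp]

theorem hinv_hcomp_cancel {a b c : C.Ob} (σ : C.Hor a b) (τ : C.Hor b c) :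
    C.hcomp (C.hinv σ) (C.hcomp σ τ) = τ := by
  rw [← C.hassoc, C.hinv_comp, C.hid_comp]

/-- Uniqueness of completions is what inverts squares: complete `a ≤ c` along the inverse of `τ`,
compose with `σ` to get a completion over `hid d`, and compare it with `hid b`. -/
theorem sq_inv {a b c d : C.Ob} {σ : C.Hor a b} {τ : C.Hor c d} (h : C.Sq σ τ) :
    C.Sq (C.hinv σ) (C.hinv τ) := by
  obtain ⟨b₁, ρ, hρ⟩ := C.exists_sq (C.hinv τ) (C.sq_left h)
  have h₁ : C.Sq (C.hcomp ρ σ) (C.hid d) := by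
    rw [← C.hinv_comp τ]; exact C.sq_hcomp hρ h
  have h₂ := C.sq_hcomp (C.sq_unique (C.sq_hid (C.sq_right h)) h₁) (C.sq_vid (C.hinv σ))
  rw [C.hid_comp, C.hassoc, C.hcomp_inv, C.hcomp_id] at h₂
  exact C.sq_vcomp h₂ hρ

/-- Vertical subobjects of the source can be pushed forward along a horizontal morphism. -/
theorem exists_push {a b a' : C.Ob} (σ : C.Hor a b) (h : a' ≤ a) :
    ∃ (b' : C.Ob) (τ : C.Hor a' b'), C.Sq τ σ := by
  obtain ⟨b', τ, hτ⟩ := C.exists_sq (C.hinv σ) h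
  refine ⟨b', C.hinv τ, ?_⟩
  have := sq_inv hτ
  rwa [hinv_hinv] at this

theorem sq_of_left_le {a b a₁ b₁ a₂ b₂ : C.Ob} {σ : C.Hor a b} {τ₁ : C.Hor a₁ b₁}
    {τ₂ : C.Hor a₂ b₂} (h₁ : C.Sq τ₁ σ) (h₂ : C.Sq τ₂ σ) (h : a₁ ≤ a₂) : C.Sq τ₁ τ₂ :=
  sq_mono h₁ h₂ ((C.sq_le_iff h₁ h₂).1 h)

/-- A square over a composite splits into two squares. -/
theorem exists_sq_hcomp {a b c x z : C.Ob} {σ : C.Hor a b} {ρ : C.Hor b c} {τ : C.Hor x z}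
    (h : C.Sq τ (C.hcomp σ ρ)) :
    ∃ (y : C.Ob) (τ₁ : C.Hor x y) (τ₂ : C.Hor y z),
      C.hcomp τ₁ τ₂ = τ ∧ C.Sq τ₁ σ ∧ C.Sq τ₂ ρ := by
  obtain ⟨y, τ₂, h₂⟩ := C.exists_sq ρ (C.sq_right h)
  obtain ⟨x', τ', h'⟩ := C.exists_sq σ (C.sq_left h₂)
  -- The two-stage completion agrees with `τ` only up to vertical isomorphism. Taking `τ` followed
  -- by the inverse of `τ₂` as first factor makes the factorization an equation.
  have h₃ := C.sq_hcomp (C.sq_unique h (C.sq_hcomp h' h₂)) (C.sq_vid (C.hinv τ₂))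
  rw [C.hassoc τ', C.hcomp_inv, C.hcomp_id] at h₃
  exact ⟨y, C.hcomp τ (C.hinv τ₂), τ₂, by rw [C.hassoc, C.hinv_comp, C.hcomp_id],
    C.sq_vcomp h₃ h', h₂⟩

theorem right_ne_bot {a b : C.Ob} (σ : C.Hor a b) (h : a ≠ C.bot) : b ≠ C.bot :=
  fun hb => h ((eq_bot_iff σ).2 hb)

theorem left_ne_bot {a b : C.Ob} (σ : C.Hor a b) (h : b ≠ C.bot) : a ≠ C.bot :=
  fun hb => h ((eq_bot_iff σ).1 hb)

theorem isGLB_pair_iff {X : Type*} [Preorder X] {a b d : X} :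
    IsGLB {a, b} d ↔ d ≤ a ∧ d ≤ b ∧ ∀ c, c ≤ a → c ≤ b → c ≤ d := by
  constructor
  · refine fun h => ⟨h.1 (by simp), h.1 (by simp), fun c ha hb => h.2 ?_⟩
    rintro x (rfl | rfl) <;> assumption
  · rintro ⟨h₁, h₂, h₃⟩
    refine ⟨?_, fun c hc => h₃ c (hc (by simp)) (hc (by simp))⟩
    rintro x (rfl | rfl) <;> assumption

/-! ## Coverings by predicates -/

/-- The predicate `P` holds on all members of some covering sieve of `a`. -/
def Cov (a : C.Ob) (P : C.Ob → Prop) : Prop :=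
  ∃ S ∈ C.J a, ∀ b (h : b ≤ a), S (homOfLE h) → P b

namespace Cov

variable {a b : C.Ob} {P Q : C.Ob → Prop}

theorem mono (h : Cov a P) (hPQ : ∀ b, b ≤ a → P b → Q b) : Cov a Q := by
  obtain ⟨S, hS, hP⟩ := h
  exact ⟨S, hS, fun b hb hb' => hPQ b hb (hP b hb hb')⟩

theorem of_forall (h : ∀ b ≤ a, P b) : Cov a P :=
  ⟨⊤, C.J.top_mem a, fun b hb _ => h b hb⟩

theorem le (h : Cov a P) (hb : b ≤ a) : Cov b P := by
  obtain ⟨S, hS, hP⟩ := h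
  refine ⟨S.pullback (homOfLE hb), C.J.pullback_stable _ hS, fun c hc hc' => ?_⟩
  exact hP c (hc.trans hb) hc'

theorem and (h : Cov a P) (h' : Cov a Q) : Cov a (fun b => P b ∧ Q b) := by
  obtain ⟨S, hS, hP⟩ := h
  obtain ⟨T, hT, hQ⟩ := h'
  exact ⟨S ⊓ T, C.J.intersection_covering hS hT, fun b hb hb' =>
    ⟨hP b hb hb'.1, hQ b hb hb'.2⟩⟩

theorem forall_of_finite {ι : Type*} [Finite ι] {R : ι → C.Ob → Prop} (h : ∀ i, Cov a (R i)) :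
    Cov a (fun b => ∀ i, R i b) := by
  classical
  cases nonempty_fintype ι
  have key : ∀ s : Finset ι, Cov a (fun b => ∀ i ∈ s, R i b) := by
    intro s
    induction s using Finset.induction_on with
    | empty => exact of_forall fun b _ i hi => absurd hi (by simp)
    | insert i s _ ih =>
      refine ((h i).and ih).mono fun b _ hb j hj => ?_
      rcases Finset.mem_insert.1 hj with rfl | hj
      · exact hb.1
      · exact hb.2 j hj
  exact (key Finset.univ).mono fun b _ hb i => hb i (Finset.mem_univ i)

theorem trans (h : Cov a P) (h' : ∀ b, b ≤ a → P b → Cov b Q) : Cov a Q := by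
  obtain ⟨S, hS, hP⟩ := h
  -- The largest sieve contained in `Q`, which need not be downward closed itself.
  let T : Sieve a :=
    { arrows := fun b _ => ∀ c, c ≤ b → Q c
      downward_closed := fun {b c} _ hb g d hd => hb d (hd.trans (leOfHom g)) }
  refine ⟨T, C.J.transitive hS T fun b f hf => ?_, fun b hb hT => hT b le_rfl⟩
  obtain ⟨R, hR, hQ⟩ := h' b (leOfHom f) (hP b (leOfHom f) hf)
  refine C.J.superset_covering ?_ hR
  intro c g hg d hd
  exact hQ d (hd.trans (leOfHom g)) (R.downward_closed hg (homOfLE hd))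

end Cov

theorem isCoveringFamily_iff {ι : Type w} {x : ι → C.Ob} {a : C.Ob} :
    IsCoveringFamily C.J x a ↔ (∀ i, x i ≤ a) ∧ Cov a (fun b => ∃ i, b ≤ x i) := by
  constructor
  · rintro ⟨h, hS⟩
    refine ⟨h, _, hS, fun b hb hb' => ?_⟩
    obtain ⟨_, g, _, ⟨i⟩, -⟩ := hb'
    exact ⟨i, leOfHom g⟩
  · rintro ⟨h, S, hS, hP⟩
    refine ⟨h, C.J.superset_covering ?_ hS⟩
    intro b f hf
    obtain ⟨i, hi⟩ := hP b (leOfHom f) hf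
    exact ⟨x i, homOfLE hi, homOfLE (h i), Presieve.ofArrows.mk i, rfl⟩

theorem cov_iff_exists_family {a : C.Ob} {P : C.Ob → Prop} :
    Cov a P ↔ ∃ S ∈ C.J a, ∀ b : {b : C.Ob // ∃ h : b ≤ a, S (homOfLE h)}, P b.1 :=
  ⟨fun ⟨S, hS, h⟩ => ⟨S, hS, fun b => h b.1 b.2.1 b.2.2⟩,
    fun ⟨S, hS, h⟩ => ⟨S, hS, fun b hb hb' => h ⟨b, hb, hb'⟩⟩⟩

/-- The members of the sieve index themselves, so the index type lies in the universe required by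
the axioms `nondegenerate` and `cover_pull`. -/
theorem isCoveringFamily_sieve {a : C.Ob} (S : Sieve a) (hS : S ∈ C.J a) :
    IsCoveringFamily C.J (fun b : {b : C.Ob // ∃ h : b ≤ a, S (homOfLE h)} => b.1) a :=
  isCoveringFamily_iff.2 ⟨fun b => b.2.1, S, hS, fun b hb hb' => ⟨⟨b, hb, hb'⟩, le_rfl⟩⟩

theorem Cov.exists_ne_bot {a : C.Ob} {P : C.Ob → Prop} (h : Cov a P) (ha : a ≠ C.bot) :
    ∃ b, b ≤ a ∧ b ≠ C.bot ∧ P b := by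
  obtain ⟨S, hS, hP⟩ := cov_iff_exists_family.1 h
  by_contra! hne
  refine ha (C.nondegenerate (isCoveringFamily_sieve S hS) fun b => ?_)
  by_contra hb
  exact hne b.1 b.2.1 hb (hP b)

/-- A covering predicate need only be checked on polytopes. -/
theorem Cov.of_ne_bot {a : C.Ob} {P : C.Ob → Prop} (ha : a ≠ C.bot)
    (hdown : ∀ b c, b ≤ c → P c → P b) (h : Cov a (fun b => b ≠ C.bot → P b)) : Cov a P := by
  -- Nondegeneracy provides a polytope satisfying `P`; the initial object lies below it, so it
  -- satisfies `P` as well.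
  obtain ⟨c, -, hc, hPc⟩ := h.exists_ne_bot ha
  refine h.mono fun b _ hb => ?_
  by_cases hb' : b = C.bot
  · exact hdown _ _ (hb' ▸ C.bot_le c) (hPc hc)
  · exact hb hb'

/-- Axiom (C) for predicates. As `P` need not be downward closed, the pushforward `y'` is only
placed below some `z` satisfying it. -/
theorem Cov.pull {a b : C.Ob} {P : C.Ob → Prop} (h : Cov b P) (σ : C.Hor a b) :
    Cov a (fun y => ∃ (y' : C.Ob) (τ : C.Hor y y'), C.Sq τ σ ∧
      ∃ z, y' ≤ z ∧ P z) := by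
  obtain ⟨S, hS, hP⟩ := cov_iff_exists_family.1 h
  choose x τ hτ using fun z : {b' : C.Ob // ∃ h : b' ≤ b, S (homOfLE h)} =>
    C.exists_sq σ z.2.1
  have := C.cover_pull σ τ hτ (isCoveringFamily_sieve S hS)
  refine (isCoveringFamily_iff.1 this).2.mono fun y _ ⟨i, hi⟩ => ?_
  obtain ⟨y', ρ, hρ⟩ := exists_push (τ i) hi
  exact ⟨y', ρ, C.sq_vcomp hρ (hτ i), i.1, C.sq_right hρ, hP i⟩

end PolytopeComplex

/-- Polytope functors preserve covering families with index types in the lowest universe. -/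
theorem PolytopeFunctor.isCoveringFamily {C D : PolytopeComplex.{v, u}} (F : PolytopeFunctor C D)
    {ι : Type} {x : ι → C.Ob} {a : C.Ob} (h : IsCoveringFamily C.J x a) :
    IsCoveringFamily D.J (fun i => F.obj (x i)) (F.obj a) := by
  rw [PolytopeComplex.isCoveringFamily_iff] at h
  have h' : IsCoveringFamily C.J (fun i : ULift.{u} ι => x i.down) a :=
    PolytopeComplex.isCoveringFamily_iff.2 ⟨fun i => h.1 _, h.2.mono fun b _ ⟨i, hi⟩ => ⟨⟨i⟩, hi⟩⟩
  have h'' := PolytopeComplex.isCoveringFamily_iff.1 (F.map_cover h')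
  exact PolytopeComplex.isCoveringFamily_iff.2
    ⟨fun i => F.mono (h.1 i), h''.2.mono fun b _ ⟨i, hi⟩ => ⟨i.down, hi⟩⟩

namespace SC

open PolytopeComplex

variable {C : PolytopeComplex.{v, u}}

/-! ## The germ relation of a morphism -/

theorem elt_ne_bot (A : SC C) (i : A.Idx) : A.elt i ≠ C.bot := i.2

/-- The horizontal morphism `τ` is a restriction of a component of the diagram `S` from the `i`-th
member of `A` to the `j`-th member of `B`. -/
def Span.Rel {A B : SC C} (S : Span A B) (i : A.Idx) (j : B.Idx) {y y' : C.Ob}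
    (τ : C.Hor y y') : Prop :=
  ∃ s, S.p s = i ∧ S.f s = j ∧ C.Sq τ (S.hor s)

theorem Span.rel_of_equiv {A B : SC C} {S T : Span A B} (h : S ≈ T) {i : A.Idx} {j : B.Idx}
    {y y' : C.Ob} {τ : C.Hor y y'} (hr : S.Rel i j τ) : T.Rel i j τ := by
  obtain ⟨ι, h⟩ := h
  obtain ⟨s, rfl, rfl, hs⟩ := hr
  obtain ⟨-, h₁, h₂, h₃⟩ := h s
  exact ⟨ι s, h₁, h₂, C.sq_vcomp hs h₃⟩

/-- Disjointness in the form used throughout: over a given index, a polytope lies in at most one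
component. -/
theorem Span.eq_of_le {A B : SC C} (S : Span A B) {s s' : S.apex.Idx} (h : S.p s = S.p s')
    {w : C.Ob} (hw : w ≠ C.bot) (h₁ : w ≤ S.apex.elt s) (h₂ : w ≤ S.apex.elt s') : s = s' := by
  by_contra hne
  exact hw (isGLB_bot_iff.1 (S.sub.disjoint s s' hne h) w h₁ h₂)

/-- Every component of `S` is itself a germ, so it lies in a component of `T`, and conversely. A
round trip ends in a component over the same index that contains the original one, so by
disjointness the two assignments are mutually inverse. -/
theorem Span.equiv_of_rel {A B : SC C} {S T : Span A B}
    (h : ∀ (i : A.Idx) (j : B.Idx) (y y' : C.Ob) (τ : C.Hor y y'), y ≠ C.bot →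
      (S.Rel i j τ ↔ T.Rel i j τ)) : S ≈ T := by
  choose f hf₁ hf₂ hf₃ using fun s => (h _ _ _ _ (S.hor s) (S.apex.elt_ne_bot s)).1
    ⟨s, rfl, rfl, C.sq_vid _⟩
  choose g hg₁ hg₂ hg₃ using fun t => (h _ _ _ _ (T.hor t) (T.apex.elt_ne_bot t)).2
    ⟨t, rfl, rfl, C.sq_vid _⟩
  have hgf : ∀ s, g (f s) = s := fun s => (S.eq_of_le (by rw [hg₁, hf₁]) (S.apex.elt_ne_bot s)
    le_rfl ((C.sq_left (hf₃ s)).trans (C.sq_left (hg₃ _)))).symm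
  have hfg : ∀ t, f (g t) = t := fun t => (T.eq_of_le (by rw [hf₁, hg₁]) (T.apex.elt_ne_bot t)
    le_rfl ((C.sq_left (hg₃ t)).trans (C.sq_left (hf₃ _)))).symm
  refine ⟨⟨f, g, hgf, hfg⟩, fun s => ⟨⟨C.sq_left (hf₃ s), ?_⟩, hf₁ s, hf₂ s, hf₃ s⟩⟩
  have := C.sq_left (hg₃ (f s))
  rwa [hgf] at this

/-- The relation `Span.Rel` of a morphism of `SC(C)`. -/
def Rel {A B : SC C} (φ : A ⟶ B) (i : A.Idx) (j : B.Idx) {y y' : C.Ob} (τ : C.Hor y y') : Prop :=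
  Quotient.liftOn φ (fun S : Span A B => S.Rel i j τ) fun _ _ h =>
    propext ⟨Span.rel_of_equiv h, Span.rel_of_equiv (Setoid.symm h)⟩

theorem exists_span {A B : SC C} (φ : A ⟶ B) : ∃ S : Span A B, S.hom = φ :=
  Quotient.exists_rep φ

theorem hom_ext {A B : SC C} {φ ψ : A ⟶ B}
    (h : ∀ (i : A.Idx) (j : B.Idx) (y y' : C.Ob) (τ : C.Hor y y'), y ≠ C.bot →
      (Rel φ i j τ ↔ Rel ψ i j τ)) : φ = ψ := by
  obtain ⟨S, rfl⟩ := exists_span φ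
  obtain ⟨T, rfl⟩ := exists_span ψ
  exact Quotient.sound (Span.equiv_of_rel h)

section

variable {A B D : SC C} {φ φ' : A ⟶ B} {ψ ψ' : B ⟶ D} {i i' : A.Idx} {j j' : B.Idx} {k : D.Idx}
  {y y' z z' x : C.Ob} {τ : C.Hor y y'} {τ' : C.Hor z z'}

theorem Rel.down (h : Rel φ i j τ) (hs : C.Sq τ' τ) : Rel φ i j τ' := by
  obtain ⟨S, rfl⟩ := exists_span φ
  obtain ⟨s, h₁, h₂, h₃⟩ := h
  exact ⟨s, h₁, h₂, C.sq_vcomp hs h₃⟩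

/-- The component of which a germ is a restriction. -/
theorem Rel.exists_component (h : Rel φ i j τ) :
    ∃ (a : C.Ob) (ρ : C.Hor a (B.elt j)), Rel φ i j ρ ∧ C.Sq τ ρ := by
  obtain ⟨S, rfl⟩ := exists_span φ
  obtain ⟨s, rfl, rfl, h₃⟩ := h
  exact ⟨_, S.hor s, ⟨s, rfl, rfl, C.sq_vid _⟩, h₃⟩

theorem Rel.le_left (h : Rel φ i j τ) : y ≤ A.elt i := by
  obtain ⟨S, rfl⟩ := exists_span φ
  obtain ⟨s, rfl, rfl, h₃⟩ := h
  exact (C.sq_left h₃).trans (S.sub.le s)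

theorem Rel.le_right (h : Rel φ i j τ) : y' ≤ B.elt j := by
  obtain ⟨S, rfl⟩ := exists_span φ
  obtain ⟨s, rfl, rfl, h₃⟩ := h
  exact C.sq_right h₃

/-- Two germs of a morphism whose sources overlap belong to the same component. -/
theorem Rel.unique (h : Rel φ i j τ) (h' : Rel φ i j' τ') {w : C.Ob} (hw : w ≠ C.bot)
    (h₁ : w ≤ y) (h₂ : w ≤ z) :
    j = j' ∧ ∃ (a : C.Ob) (ρ : C.Hor a (B.elt j)), Rel φ i j ρ ∧ C.Sq τ ρ ∧ C.Sq τ' ρ := by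
  obtain ⟨S, rfl⟩ := exists_span φ
  obtain ⟨s, rfl, rfl, h₃⟩ := h
  obtain ⟨s', h₄, rfl, h₅⟩ := h'
  obtain rfl := S.eq_of_le h₄.symm hw (h₁.trans (C.sq_left h₃)) (h₂.trans (C.sq_left h₅))
  exact ⟨rfl, _, S.hor s, ⟨s, rfl, rfl, C.sq_vid _⟩, h₃, h₅⟩

/-- Germs with a common source overlap, so both restrict one component. Their targets agree only up
to vertical isomorphism, whence two squares instead of an equation. -/
theorem Rel.unique_source {τ' : C.Hor y z} (h : Rel φ i j τ) (h' : Rel φ i j' τ')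
    (hy : y ≠ C.bot) : j = j' ∧ C.Sq τ τ' ∧ C.Sq τ' τ := by
  obtain ⟨rfl, a, ρ, -, h₁, h₂⟩ := h.unique h' hy le_rfl le_rfl
  exact ⟨rfl, sq_of_left_le h₁ h₂ le_rfl, sq_of_left_le h₂ h₁ le_rfl⟩

theorem Rel.comp {τ' : C.Hor y' z} (h : Rel φ i j τ) (h' : Rel ψ j k τ') :
    Rel (φ ≫ ψ) i k (C.hcomp τ τ') := by
  obtain ⟨S, rfl⟩ := exists_span φ
  obtain ⟨T, rfl⟩ := exists_span ψ
  obtain ⟨U, hU⟩ : ∃ U, Span.IsComp S T U := ⟨_, Span.comp_isComp S T⟩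
  rw [Span.hom_comp hU]
  obtain ⟨s, rfl, rfl, hs⟩ := h
  obtain ⟨t, ht, rfl, ht'⟩ := h'
  obtain ⟨e, he⟩ := hU
  obtain ⟨u, hu⟩ := e.surjective ⟨(s, t), ht.symm⟩
  obtain ⟨h₁, h₂, κ, h₃, h₄⟩ := he u
  have h₅ := sq_symm h₄ (by rw [h₂])
  revert h₁ h₂ κ h₃ h₄
  rw [hu]
  intro h₁ h₂ κ h₃ h₄ h₅
  exact ⟨u, h₁, h₂, C.sq_vcomp (C.sq_hcomp (sq_mono hs h₃ (C.sq_left ht')) ht') h₅⟩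

/-- The germ lies over a composite of two horizontal morphisms, and `exists_sq_hcomp` splits it
strictly. Thus no trace of the chosen pullback in `Span.comp` remains. -/
theorem Rel.of_comp (h : Rel (φ ≫ ψ) i k τ) :
    ∃ (j : B.Idx) (x : C.Ob) (τ₁ : C.Hor y x) (τ₂ : C.Hor x y'),
      C.hcomp τ₁ τ₂ = τ ∧ Rel φ i j τ₁ ∧ Rel ψ j k τ₂ := by
  obtain ⟨S, rfl⟩ := exists_span φ
  obtain ⟨T, rfl⟩ := exists_span ψ
  obtain ⟨U, hU⟩ : ∃ U, Span.IsComp S T U := ⟨_, Span.comp_isComp S T⟩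
  rw [Span.hom_comp hU] at h
  obtain ⟨u, rfl, rfl, hu⟩ := h
  obtain ⟨e, he⟩ := hU
  obtain ⟨h₁, h₂, κ, h₃, h₄⟩ := he u
  obtain ⟨x, τ₁, τ₂, h₅, h₆, h₇⟩ := exists_sq_hcomp (C.sq_vcomp hu h₄)
  exact ⟨_, x, τ₁, τ₂, h₅, ⟨_, h₁.symm, rfl, C.sq_vcomp h₆ h₃⟩, ⟨_, (e u).2.symm, h₂.symm, h₇⟩⟩

theorem rel_id_iff {i' : A.Idx} :
    Rel (𝟙 A) i i' τ ↔ i = i' ∧ C.Sq τ (C.hid (A.elt i)) := by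
  constructor
  · rintro ⟨s, rfl, rfl, h⟩
    exact ⟨rfl, h⟩
  · rintro ⟨rfl, h⟩
    exact ⟨i, rfl, rfl, h⟩

theorem rel_id_hid (hy : y ≤ A.elt i) : Rel (𝟙 A) i i (C.hid y) :=
  rel_id_iff.2 ⟨rfl, C.sq_hid hy⟩

/-! ## Domain and image of a morphism -/

/-- `y` lies in a component of `φ` on the `i`-th member of the source. -/
def Dom (φ : A ⟶ B) (i : A.Idx) (y : C.Ob) : Prop :=
  ∃ (j : B.Idx) (y' : C.Ob) (τ : C.Hor y y'), Rel φ i j τ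

/-- The index `j` is in the image of `φ`. -/
def Im (φ : A ⟶ B) (j : B.Idx) : Prop :=
  ∃ (i : A.Idx) (y y' : C.Ob) (τ : C.Hor y y'), Rel φ i j τ

/-- `φ` is totally defined, up to a covering, on the `i`-th member of the source. -/
def TotalAt (φ : A ⟶ B) (i : A.Idx) : Prop := Cov (A.elt i) (Dom φ i)

/-- At most one component of `φ` maps to the `j`-th member of the target. -/
def InjAt (φ : A ⟶ B) (j : B.Idx) : Prop :=
  ∀ ⦃i i' : A.Idx⦄ ⦃y z x : C.Ob⦄ ⦃τ : C.Hor y x⦄ ⦃τ' : C.Hor z x⦄, x ≠ C.bot →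
    Rel φ i j τ → Rel φ i' j τ' → i = i' ∧ C.Sq τ τ'

theorem Rel.dom (h : Rel φ i j τ) : Dom φ i y := ⟨_, _, _, h⟩

theorem Rel.im (h : Rel φ i j τ) : Im φ j := ⟨_, _, _, _, h⟩

theorem Dom.le (h : Dom φ i y) (hz : z ≤ y) : Dom φ i z := by
  obtain ⟨j, y', τ, h⟩ := h
  obtain ⟨z', ρ, hρ⟩ := exists_push τ hz
  exact ⟨j, z', ρ, h.down hρ⟩

theorem Im.exists_rel (h : Im φ j) (hx : x ≤ B.elt j) :
    ∃ (i : A.Idx) (y : C.Ob) (τ : C.Hor y x), Rel φ i j τ := by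
  obtain ⟨i, y, y', τ, h⟩ := h
  obtain ⟨a, ρ, h, -⟩ := h.exists_component
  obtain ⟨z, κ, hκ⟩ := C.exists_sq ρ hx
  exact ⟨i, z, κ, h.down hκ⟩

theorem Im.of_comp (h : Im (φ ≫ ψ) k) : Im ψ k := by
  obtain ⟨i, y, y', τ, h⟩ := h
  obtain ⟨j, x, τ₁, τ₂, -, -, h⟩ := h.of_comp
  exact h.im

theorem Im.comp {y y' : C.Ob} {τ : C.Hor y y'} (h : Im φ j) (h' : Rel ψ j k τ) :
    Im (φ ≫ ψ) k := by
  obtain ⟨i, z, ρ, hρ⟩ := h.exists_rel h'.le_left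
  exact (hρ.comp h').im

theorem Dom.of_comp (h : Dom (φ ≫ ψ) i y) : Dom φ i y := by
  obtain ⟨k, y', τ, h⟩ := h
  obtain ⟨j, x, τ₁, τ₂, -, h, -⟩ := h.of_comp
  exact h.dom

theorem TotalAt.of_comp (h : TotalAt (φ ≫ ψ) i) : TotalAt φ i :=
  Cov.mono h fun _ _ => Dom.of_comp

theorem totalAt_id (i : A.Idx) : TotalAt (𝟙 A) i :=
  Cov.of_forall fun _ hb => (rel_id_hid hb).dom

/-- If `j` is in the image of `φ`, and `φ ≫ ψ` is total wherever `φ` maps to `j`, then `ψ` is total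
at `j`. -/
theorem TotalAt.of_comp_of_im
    (h : ∀ (i : A.Idx) (y y' : C.Ob) (τ : C.Hor y y'), Rel φ i j τ → TotalAt (φ ≫ ψ) i)
    (hj : Im φ j) : TotalAt ψ j := by
  obtain ⟨i, y, τ, hτ⟩ := hj.exists_rel le_rfl
  refine Cov.of_ne_bot (B.elt_ne_bot j) (fun b c hbc hc => hc.le hbc) ?_
  -- `τ` maps onto all of `B.elt j`, so the covering of its source on which `φ ≫ ψ` is defined is
  -- carried across `τ` to a covering of `B.elt j`.
  refine (((h i _ _ τ hτ).le hτ.le_left).pull (C.hinv τ)).mono ?_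
  rintro w - ⟨w', κ, hκ, z, hz, hd⟩ hw
  obtain ⟨k, x, ρ, hρ⟩ := hd.le hz
  obtain ⟨j', x', ρ₁, ρ₂, rfl, h₁, h₂⟩ := hρ.of_comp
  have h₃ : Rel φ i j (C.hinv κ) := hτ.down (by have := sq_inv hκ; rwa [hinv_hinv] at this)
  obtain ⟨rfl, h₄, -⟩ := h₃.unique_source h₁ (right_ne_bot κ hw)
  exact h₂.dom.le (C.sq_right h₄)

theorem TotalAt.comp (h : TotalAt φ i)
    (h' : ∀ (j : B.Idx) (y y' : C.Ob) (τ : C.Hor y y'), Rel φ i j τ → TotalAt ψ j) :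
    TotalAt (φ ≫ ψ) i := by
  refine Cov.trans h ?_
  rintro y - ⟨j, y', τ, hτ⟩
  refine (((h' j y y' τ hτ).le hτ.le_right).pull τ).mono ?_
  rintro w - ⟨w', ρ, hρ, z, hz, hd⟩
  obtain ⟨k, x, κ, hκ⟩ := hd.le hz
  exact ((hτ.down hρ).comp hκ).dom

theorem InjAt.apply_le (h : InjAt φ j) (hτ : Rel φ i j τ) (hτ' : Rel φ i' j τ')
    (hle : y' ≤ z') (hy : y' ≠ C.bot) : i = i' ∧ C.Sq τ τ' := by
  obtain ⟨w, ρ, hρ⟩ := C.exists_sq τ' hle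
  obtain ⟨rfl, h₁⟩ := h hy hτ (hτ'.down hρ)
  exact ⟨rfl, C.sq_vcomp h₁ hρ⟩

theorem injAt_id (j : A.Idx) : InjAt (𝟙 A) j := by
  rintro i i' y z x τ τ' hx h h'
  obtain ⟨rfl, h₁⟩ := rel_id_iff.1 h
  obtain ⟨rfl, h₂⟩ := rel_id_iff.1 h'
  exact ⟨rfl, C.sq_unique h₁ h₂⟩

theorem InjAt.comp (h : ∀ j, InjAt φ j) (h' : InjAt ψ k) : InjAt (φ ≫ ψ) k := by
  rintro i i' y z x τ τ' hx hτ hτ'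
  obtain ⟨j, x₁, τ₁, τ₂, rfl, h₁, h₂⟩ := hτ.of_comp
  obtain ⟨j', x₁', τ₁', τ₂', rfl, h₁', h₂'⟩ := hτ'.of_comp
  obtain ⟨rfl, h₃⟩ := h' hx h₂ h₂'
  obtain ⟨rfl, h₄⟩ := (h j).apply_le h₁ h₁' (C.sq_left h₃) (left_ne_bot τ₂ hx)
  exact ⟨rfl, C.sq_hcomp h₄ h₃⟩

/-- Totality of `ψ` gives a polytope below the common target on which `ψ` is defined. After
restriction to it and composition with `ψ`, injectivity of the composite makes the two sources
overlap, and overlapping germs belong to one component. -/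
theorem InjAt.of_comp (h : ∀ k, InjAt (φ ≫ ψ) k) (h' : TotalAt ψ j) : InjAt φ j := by
  rintro i i' y z x τ τ' hx hτ hτ'
  obtain ⟨w', hw', hw'bot, k, w'', κ, hκ⟩ := (Cov.le h' hτ.le_right).exists_ne_bot hx
  obtain ⟨w, ρ, hρ⟩ := C.exists_sq τ hw'
  obtain ⟨v, ρ', hρ'⟩ := C.exists_sq τ' hw'
  obtain ⟨rfl, h₁⟩ := h k (right_ne_bot κ hw'bot) ((hτ.down hρ).comp hκ) ((hτ'.down hρ').comp hκ)
  refine ⟨rfl, ?_⟩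
  obtain ⟨-, a, σ, -, h₂, h₃⟩ := hτ.unique hτ' (left_ne_bot ρ hw'bot) (C.sq_left hρ)
    ((C.sq_left h₁).trans (C.sq_left hρ'))
  exact C.sq_unique h₂ h₃

/-- Injectivity of `ψ` can be checked after precomposition, on the image. -/
theorem InjAt.of_comp_of_im (h : InjAt (φ ≫ ψ) k) (hj : Im φ j) (hj' : Im φ j')
    {τ : C.Hor y x} {τ' : C.Hor z x} (hx : x ≠ C.bot) (hτ : Rel ψ j k τ) (hτ' : Rel ψ j' k τ') :
    j = j' ∧ C.Sq τ τ' := by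
  obtain ⟨i, w, ρ, hρ⟩ := hj.exists_rel hτ.le_left
  obtain ⟨i', w', ρ', hρ'⟩ := hj'.exists_rel hτ'.le_left
  obtain ⟨rfl, h₁⟩ := h hx (hρ.comp hτ) (hρ'.comp hτ')
  obtain ⟨rfl, a, σ, -, h₂, h₃⟩ := hρ.unique hρ' (left_ne_bot ρ (left_ne_bot τ hx)) le_rfl
    (C.sq_left h₁)
  refine ⟨rfl, ?_⟩
  have := C.sq_hcomp (sq_inv (sq_of_left_le h₂ h₃ (C.sq_left h₁))) h₁
  rwa [hinv_hcomp_cancel, hinv_hcomp_cancel] at this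

/-- On the image of `φ`, the germs of `ψ` are determined by those of `φ ≫ ψ`. -/
theorem Im.rel_of_comp_eq (h : φ ≫ ψ = φ ≫ ψ') (hj : Im φ j) (hy : y ≠ C.bot)
    (hτ : Rel ψ j k τ) : Rel ψ' j k τ := by
  obtain ⟨i, w, ρ, hρ⟩ := hj.exists_rel hτ.le_left
  have h₁ := hρ.comp hτ
  rw [h] at h₁
  obtain ⟨j', x, ρ₁, τ₁, h₂, h₃, h₄⟩ := h₁.of_comp
  obtain ⟨rfl, h₅, -⟩ := hρ.unique_source h₃ (left_ne_bot ρ hy)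
  refine h₄.down ?_
  have := C.sq_hcomp (sq_inv h₅) (C.sq_vid (C.hcomp ρ₁ τ₁))
  rwa [hinv_hcomp_cancel, h₂, hinv_hcomp_cancel] at this

end

/-! ## Cofibrations and weak equivalences in terms of germs -/

section

variable {A B D : SC C}

theorem Span.isCoveringSubmap_iff (S : Span A B) :
    IsCoveringSubmap S.apex.elt A.elt S.p ↔ ∀ i, TotalAt S.hom i := by
  have key : ∀ i y, Dom S.hom i y ↔ ∃ s : {s // S.p s = i}, y ≤ S.apex.elt s.1 := by
    intro i y
    constructor
    · rintro ⟨j, y', τ, s, h₁, h₂, h₃⟩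
      exact ⟨⟨s, h₁⟩, C.sq_left h₃⟩
    · rintro ⟨⟨s, rfl⟩, h⟩
      obtain ⟨y', τ, hτ⟩ := exists_push (S.hor s) h
      exact ⟨S.f s, y', τ, s, rfl, rfl, hτ⟩
  constructor
  · exact fun h i => (isCoveringFamily_iff.1 (h.cover i)).2.mono fun y _ hy => (key i y).2 hy
  · refine fun h => ⟨S.sub, fun i => isCoveringFamily_iff.2 ⟨?_, ?_⟩⟩
    · rintro ⟨s, rfl⟩
      exact S.sub.le s
    · exact Cov.mono (h i) fun y _ hy => (key i y).1 hy

theorem Span.injective_iff (S : Span A B) :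
    Function.Injective S.f ↔ ∀ j, InjAt S.hom j := by
  constructor
  · rintro h j i i' y z x τ τ' hx ⟨s, rfl, rfl, h₁⟩ ⟨s', rfl, h₂, h₃⟩
    obtain rfl := h h₂
    exact ⟨rfl, C.sq_unique h₁ h₃⟩
  · intro h s s' hs
    obtain ⟨h₁, h₂⟩ := (h (S.f s)).apply_le (φ := S.hom) (τ := S.hor s) (τ' := S.hor s')
      ⟨s, rfl, rfl, C.sq_vid _⟩ ⟨s', rfl, hs.symm, C.sq_vid _⟩ (by rw [hs]) (B.elt_ne_bot _)
    exact S.eq_of_le h₁ (S.apex.elt_ne_bot s) le_rfl (C.sq_left h₂)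

theorem Span.im_iff (S : Span A B) (j : B.Idx) : Im S.hom j ↔ ∃ s, S.f s = j := by
  constructor
  · rintro ⟨i, y, y', τ, s, -, h, -⟩
    exact ⟨s, h⟩
  · rintro ⟨s, rfl⟩
    exact ⟨_, _, _, S.hor s, s, rfl, rfl, C.sq_vid _⟩

theorem cof_iff {φ : A ⟶ B} : cof C φ ↔ (∀ i, TotalAt φ i) ∧ ∀ j, InjAt φ j := by
  constructor
  · rintro ⟨S, rfl, h₁, h₂⟩
    exact ⟨S.isCoveringSubmap_iff.1 h₁, S.injective_iff.1 h₂⟩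
  · rintro ⟨h₁, h₂⟩
    obtain ⟨S, rfl⟩ := exists_span φ
    exact ⟨S, rfl, S.isCoveringSubmap_iff.2 h₁, S.injective_iff.2 h₂⟩

theorem weq_iff {φ : A ⟶ B} :
    weq C φ ↔ (∀ i, TotalAt φ i) ∧ (∀ j, InjAt φ j) ∧ ∀ j, Im φ j := by
  constructor
  · rintro ⟨S, rfl, h₁, h₂⟩
    exact ⟨S.isCoveringSubmap_iff.1 h₁, S.injective_iff.1 h₂.1, fun j => (S.im_iff j).2 (h₂.2 j)⟩
  · rintro ⟨h₁, h₂, h₃⟩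
    obtain ⟨S, rfl⟩ := exists_span φ
    exact ⟨S, rfl, S.isCoveringSubmap_iff.2 h₁, S.injective_iff.2 h₂,
      fun j => (S.im_iff j).1 (h₃ j)⟩

theorem cof_of_weq {φ : A ⟶ B} (h : weq C φ) : cof C φ := by
  rw [weq_iff] at h
  exact cof_iff.2 ⟨h.1, h.2.1⟩

theorem im_id (i : A.Idx) : Im (𝟙 A) i := (rel_id_hid le_rfl).im

theorem weq_of_isIso {φ : A ⟶ B} (h : IsIso φ) : weq C φ := by
  have h₁ : φ ≫ inv φ = 𝟙 A := IsIso.hom_inv_id φ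
  have h₂ : inv φ ≫ φ = 𝟙 B := IsIso.inv_hom_id φ
  refine weq_iff.2 ⟨fun i => TotalAt.of_comp (ψ := inv φ) ?_, fun j => ?_, fun j => ?_⟩
  · rw [h₁]; exact totalAt_id i
  · refine InjAt.of_comp (ψ := inv φ) (fun k => ?_) (TotalAt.of_comp (ψ := φ) ?_)
    · rw [h₁]; exact injAt_id k
    · rw [h₂]; exact totalAt_id j
  · apply Im.of_comp (φ := inv φ)
    rw [h₂]; exact im_id j

theorem weq_comp {φ : A ⟶ B} {ψ : B ⟶ D} (h : weq C φ) (h' : weq C ψ) : weq C (φ ≫ ψ) := by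
  rw [weq_iff] at h h' ⊢
  refine ⟨fun i => (h.1 i).comp fun j _ _ _ _ => h'.1 j, fun k => InjAt.comp h.2.1 (h'.2.1 k),
    fun k => ?_⟩
  obtain ⟨j, y, y', τ, hτ⟩ := h'.2.2 k
  exact (h.2.2 j).comp hτ

theorem cof_comp {φ : A ⟶ B} {ψ : B ⟶ D} (h : cof C φ) (h' : cof C ψ) : cof C (φ ≫ ψ) := by
  rw [cof_iff] at h h' ⊢
  exact ⟨fun i => (h.1 i).comp fun j _ _ _ _ => h'.1 j, fun k => InjAt.comp h.2 (h'.2 k)⟩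

theorem weq_of_comp_left {φ : A ⟶ B} {ψ : B ⟶ D} (h : weq C φ) (h' : weq C (φ ≫ ψ)) :
    weq C ψ := by
  rw [weq_iff] at h h' ⊢
  exact ⟨fun j => TotalAt.of_comp_of_im (fun i _ _ _ _ => h'.1 i) (h.2.2 j),
    fun k _ _ _ _ _ _ _ hx hτ hτ' => (h'.2.1 k).of_comp_of_im (h.2.2 _) (h.2.2 _) hx hτ hτ',
    fun k => (h'.2.2 k).of_comp⟩

theorem weq_of_comp_right {φ : A ⟶ B} {ψ : B ⟶ D} (h : weq C ψ) (h' : weq C (φ ≫ ψ)) :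
    weq C φ := by
  rw [weq_iff] at h h' ⊢
  refine ⟨fun i => (h'.1 i).of_comp, fun j => InjAt.of_comp h'.2.1 (h.1 j), fun j => ?_⟩
  -- Surjectivity at `j`: `ψ` maps a polytope below `B.elt j` into some member `k`, which `φ ≫ ψ`
  -- reaches through some `j'`. Injectivity of `ψ` at `k` then gives `j' = j`.
  obtain ⟨w', -, hw', k, w'', κ, hκ⟩ := (h.1 j).exists_ne_bot (B.elt_ne_bot j)
  obtain ⟨i, w, ρ, hρ⟩ := (h'.2.2 k).exists_rel hκ.le_right
  obtain ⟨j', x, ρ₁, ρ₂, rfl, h₁, h₂⟩ := hρ.of_comp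
  obtain ⟨rfl, -⟩ := h.2.1 k (right_ne_bot κ hw') h₂ hκ
  exact h₁.im

theorem weq_hasTwoOutOfThreeProperty (C : PolytopeComplex.{v, u}) :
    (weq C).HasTwoOutOfThreeProperty where
  comp_mem _ _ := weq_comp
  of_postcomp _ _ := weq_of_comp_right
  of_precomp _ _ := weq_of_comp_left

/-- An isomorphism consists of one component for every index. -/
theorem dom_elt_of_isIso {φ : A ⟶ B} (h : IsIso φ) (i : A.Idx) : Dom φ i (A.elt i) := by
  apply Dom.of_comp (ψ := inv φ)
  rw [IsIso.hom_inv_id]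
  exact (rel_id_hid le_rfl).dom

/-! ## The zero object -/

theorem isZero_of_isEmpty {Z : SC C} (h : IsEmpty Z.Idx) : IsZero Z := by
  have key : ∀ {X Y : SC C}, (IsEmpty X.Idx ∨ IsEmpty Y.Idx) → ∀ f g : X ⟶ Y, f = g := by
    intro X Y hXY f g
    refine hom_ext fun i j _ _ _ _ => ?_
    rcases hXY with h | h
    · exact h.elim i
    · exact h.elim j
  have from' : ∀ X : SC C, Nonempty (Z ⟶ X) := fun X => ⟨Span.hom
    { apex := Z, p := id, sub := ⟨fun i => h.elim i, fun i => h.elim i⟩, f := fun i => h.elim i,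
      hor := fun i => h.elim i }⟩
  have to' : ∀ X : SC C, Nonempty (X ⟶ Z) := fun X => ⟨Span.hom
    { apex := Z, p := fun i => h.elim i, sub := ⟨fun i => h.elim i, fun i => h.elim i⟩, f := id,
      hor := fun i => h.elim i }⟩
  exact ⟨fun X => ⟨⟨⟨(from' X).some⟩, fun f => key (Or.inl h) _ _⟩⟩,
    fun X => ⟨⟨⟨(to' X).some⟩, fun f => key (Or.inr h) _ _⟩⟩⟩

/-- The empty family. -/
def empty (C : PolytopeComplex.{v, u}) : SC C where
  val _ := C.bot
  finite := by simp

instance : IsEmpty (empty C).Idx := ⟨fun i => i.2 rfl⟩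

theorem isZero_empty (C : PolytopeComplex.{v, u}) : IsZero (empty C) :=
  isZero_of_isEmpty inferInstance

/-- The identity factors through the empty family, so none of its germs could exist, whereas each
index provides one. -/
theorem isEmpty_of_isZero {Z : SC C} (h : IsZero Z) : IsEmpty Z.Idx := by
  refine ⟨fun i => ?_⟩
  have h₁ : 𝟙 Z = (isZero_empty C).from_ Z ≫ (isZero_empty C).to_ Z := h.eq_of_src _ _
  have h₂ : Rel (𝟙 Z) i i (C.hid (Z.elt i)) := rel_id_hid le_rfl
  rw [h₁] at h₂
  obtain ⟨j, -⟩ := h₂.of_comp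
  exact isEmptyElim j

theorem cof_of_isZero {Z : SC C} (h : IsZero Z) (φ : Z ⟶ A) : cof C φ := by
  have := isEmpty_of_isZero h
  exact cof_iff.2 ⟨fun i => isEmptyElim i, fun j i => isEmptyElim i⟩

end

end SC

namespace PolytopeComplex

variable {C : PolytopeComplex.{v, u}}

/-! ## Common refinements -/

/-- The pullback of `y` along `σ` lies in `t`. -/
def PullLe {a b : C.Ob} (σ : C.Hor a b) (t y : C.Ob) : Prop :=
  ∃ (w : C.Ob) (κ : C.Hor w y), C.Sq κ σ ∧ w ≤ t

/-- `m` is the largest subobject of `b₀` whose pullback along every `σ i` lies in `t i`. -/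
structure IsPiece {ι : Type*} (b₀ : C.Ob) {a b : ι → C.Ob} (σ : ∀ i, C.Hor (a i) (b i))
    (t : ι → C.Ob) (m : C.Ob) : Prop where
  le : m ≤ b₀
  pullLe : ∀ i, PullLe (σ i) (t i) m
  max : ∀ y, y ≤ b₀ → (∀ i, PullLe (σ i) (t i) y) → y ≤ m

theorem PullLe.le {a b : C.Ob} {σ : C.Hor a b} {t y z : C.Ob} (h : PullLe σ t y) (hz : z ≤ y) :
    PullLe σ t z := by
  obtain ⟨w, κ, h₁, h₂⟩ := h
  obtain ⟨v, ρ, hρ⟩ := C.exists_sq κ hz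
  exact ⟨v, ρ, C.sq_vcomp hρ h₁, (C.sq_left hρ).trans h₂⟩

/-- The pushforward of `a ×_c t` along `σ` represents the condition. Pieces therefore reduce to
finite intersections of subobjects. -/
theorem pullLe_iff_le {a b : C.Ob} {σ : C.Hor a b} {t w₀ t₀ y : C.Ob} (hw : IsGLB {a, t} w₀)
    {τ : C.Hor w₀ t₀} (hτ : C.Sq τ σ) : PullLe σ t y ↔ y ≤ t₀ := by
  obtain ⟨h₁, h₂, h₃⟩ := isGLB_pair_iff.1 hw
  constructor
  · rintro ⟨w, κ, hκ, hwt⟩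
    exact (C.sq_le_iff hκ hτ).1 (h₃ w (C.sq_left hκ) hwt)
  · exact fun h => PullLe.le ⟨w₀, τ, hτ, h₂⟩ h

/-- Pieces exist, and are preserved by polytope functors. -/
theorem exists_isPiece {D : PolytopeComplex.{v, u}} (F : C ⟶ D) {ι : Type*} [Finite ι] {b₀ : C.Ob}
    {a b : ι → C.Ob} (σ : ∀ i, C.Hor (a i) (b i)) (hb : ∀ i, b i = b₀) (t : ι → C.Ob)
    (ht : ∀ i, ∃ c, a i ≤ c ∧ t i ≤ c) :
    ∃ m, IsPiece b₀ σ t m ∧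
      IsPiece (F.obj b₀) (fun i => F.hmap (σ i)) (fun i => F.obj (t i)) (F.obj m) := by
  classical
  choose c hac htc using ht
  choose w₀ hw₀ using fun i => C.exists_pullback (hac i) (htc i)
  choose t₀ τ hτ using fun i => exists_push (σ i) (isGLB_pair_iff.1 (hw₀ i)).1
  have h₁ : ∀ i y, PullLe (σ i) (t i) y ↔ y ≤ t₀ i := fun i y => pullLe_iff_le (hw₀ i) (hτ i)
  have h₂ : ∀ i y, PullLe (F.hmap (σ i)) (F.obj (t i)) y ↔ y ≤ F.obj (t₀ i) := fun i y =>
    pullLe_iff_le (F.map_pullback (hac i) (htc i) (hw₀ i)) (F.sq (hτ i))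
  have ht₀ : ∀ i, t₀ i ≤ b₀ := fun i => by rw [← hb i]; exact C.sq_right (hτ i)
  -- One condition is intersected at a time. For the image under `F` only maximality has to be
  -- carried along; the other clauses follow from monotonicity.
  have key : ∀ s : Finset ι, ∃ m,
      (m ≤ b₀ ∧ (∀ i ∈ s, m ≤ t₀ i) ∧ ∀ y, y ≤ b₀ → (∀ i ∈ s, y ≤ t₀ i) → y ≤ m) ∧
      (∀ y, y ≤ F.obj b₀ → (∀ i ∈ s, y ≤ F.obj (t₀ i)) → y ≤ F.obj m) := by
    intro s
    induction s using Finset.induction_on with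
    | empty => exact ⟨b₀, ⟨le_rfl, by simp, fun y hy _ => hy⟩, fun y hy _ => hy⟩
    | insert i s _ ih =>
      obtain ⟨m, ⟨h₃, h₄, h₅⟩, h₆⟩ := ih
      obtain ⟨m', hm'⟩ := C.exists_pullback h₃ (ht₀ i)
      obtain ⟨h₇, h₈, h₉⟩ := isGLB_pair_iff.1 hm'
      have hF := (isGLB_pair_iff.1 (F.map_pullback h₃ (ht₀ i) hm')).2.2
      refine ⟨m', ⟨h₇.trans h₃, fun k hk => ?_, fun y hy hys => ?_⟩, fun y hy hys => ?_⟩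
      · rcases Finset.mem_insert.1 hk with rfl | hk
        · exact h₈
        · exact h₇.trans (h₄ k hk)
      · exact h₉ y (h₅ y hy fun k hk => hys k (Finset.mem_insert_of_mem hk))
          (hys i (Finset.mem_insert_self _ _))
      · exact hF y (h₆ y hy fun k hk => hys k (Finset.mem_insert_of_mem hk))
          (hys i (Finset.mem_insert_self _ _))
  cases nonempty_fintype ι
  obtain ⟨m, ⟨h₃, h₄, h₅⟩, h₆⟩ := key Finset.univ
  refine ⟨m, ⟨h₃, fun i => (h₁ i m).2 (h₄ i (Finset.mem_univ i)), fun y hy hys =>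
    h₅ y hy fun i _ => (h₁ i y).1 (hys i)⟩, ⟨F.mono h₃, fun i => (h₂ i _).2
    (F.mono (h₄ i (Finset.mem_univ i))), fun y hy hys => h₆ y hy fun i _ => (h₂ i y).1 (hys i)⟩⟩

end PolytopeComplex

namespace SC

open PolytopeComplex

variable {C : PolytopeComplex.{v, u}}

/-! ## Constructing objects and morphisms -/

theorem exists_obj {I : Type} [Finite I] (x : I → C.Ob) (hx : ∀ i, x i ≠ C.bot) :
    ∃ (P : SC C) (e : P.Idx ≃ I), ∀ k, P.elt k = x (e k) :=
  ⟨_, _, ofFamily_elt x hx ((Finite.equivFin I).toEmbedding.trans Fin.valEmbedding)⟩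

/-- Components may be indexed by any finite type: their renaming by natural numbers is invisible to
germs. -/
theorem exists_hom {A B : SC C} {I : Type} [Finite I] (x : I → C.Ob) (hx : ∀ s, x s ≠ C.bot)
    (p : I → A.Idx) (f : I → B.Idx) (hor : ∀ s, C.Hor (x s) (B.elt (f s)))
    (hle : ∀ s, x s ≤ A.elt (p s))
    (hdis : ∀ s s' w, w ≠ C.bot → p s = p s' → w ≤ x s → w ≤ x s' → s = s') :
    ∃ φ : A ⟶ B, ∀ (i : A.Idx) (j : B.Idx) (y y' : C.Ob) (τ : C.Hor y y'),
      Rel φ i j τ ↔ ∃ s, p s = i ∧ f s = j ∧ C.Sq τ (hor s) := by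
  obtain ⟨P, e, he⟩ := exists_obj x hx
  have key : ∀ k, ∃ σ : C.Hor (P.elt k) (B.elt (f (e k))),
      C.Sq σ (hor (e k)) ∧ C.Sq (hor (e k)) σ := by
    intro k
    rw [he k]
    exact ⟨hor (e k), C.sq_vid _, C.sq_vid _⟩
  choose σ hσ₁ hσ₂ using key
  refine ⟨Span.hom
    { apex := P, p := fun k => p (e k), f := fun k => f (e k), hor := σ,
      sub := ⟨fun k => by rw [he]; exact hle _, fun k k' hk hp => ?_⟩ }, fun i j y y' τ => ?_⟩
  · rw [isGLB_bot_iff]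
    intro w hw hw'
    by_contra hne
    rw [he] at hw hw'
    exact hk (e.injective (hdis _ _ w hne hp hw hw'))
  · constructor
    · rintro ⟨k, h₁, h₂, h₃⟩
      exact ⟨e k, h₁, h₂, C.sq_vcomp h₃ (hσ₁ k)⟩
    · rintro ⟨s, h₁, h₂, h₃⟩
      obtain ⟨k, rfl⟩ := e.surjective s
      exact ⟨k, h₁, h₂, C.sq_vcomp h₃ (hσ₂ k)⟩

/-! ## Pushouts along cofibrations -/

/-- The properties of a pushout square along a cofibration that are invariant under isomorphism. -/
structure PushoutFacts {A B X P : SC C} (i : A ⟶ B) (f : A ⟶ X) (g : B ⟶ P) (j : X ⟶ P) :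
    Prop where
  comm : i ≫ g = f ≫ j
  total : ∀ x, TotalAt j x
  inj : ∀ k, InjAt j k
  im_or : ∀ k, Im j k ∨ ∃ b, ¬ Im i b ∧ ∃ (y y' : C.Ob) (τ : C.Hor y y'), Rel g b k τ
  dom : ∀ b, ¬ Im i b → Dom g b (B.elt b)
  not_im : ∀ {b k} {y y' : C.Ob} {τ : C.Hor y y'}, Rel g b k τ → ¬ Im i b → ¬ Im j k
  eq_of_rel : ∀ {b b₁ k} {y y' z z' : C.Ob} {τ : C.Hor y y'} {τ' : C.Hor z z'},
    Rel g b k τ → Rel g b₁ k τ' → ¬ Im i b → ¬ Im i b₁ → b = b₁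

/-- The target of the right leg is as coarse as possible. -/
def IsMaximal {A B X P : SC C} (Q : Span A B) (S : Span A X) (j : X ⟶ P) : Prop :=
  ∀ (x : X.Idx) (c : {s // S.f s = x} → Q.apex.Idx), (∀ s, Q.p (c s) = S.p s.1) →
    ∀ m, m ≠ C.bot →
      IsPiece (X.elt x) (fun s : {s // S.f s = x} => S.hor s.1) (fun s => Q.apex.elt (c s)) m →
      Dom j x m

namespace PushoutFacts

variable {A B X P : SC C} {i : A ⟶ B} {f : A ⟶ X} {g : B ⟶ P} {j : X ⟶ P}

theorem im_of_rel (h : PushoutFacts i f g j) {b : B.Idx} {k : P.Idx} {y y' : C.Ob}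
    {τ : C.Hor y y'} (hb : Im i b) (hg : Rel g b k τ) : Im j k := by
  have := hb.comp hg
  rw [h.comm] at this
  exact this.of_comp

theorem not_im_of_rel (h : PushoutFacts i f g j) {b : B.Idx} {k : P.Idx} {y y' : C.Ob}
    {τ : C.Hor y y'} (hk : ¬ Im j k) (hg : Rel g b k τ) : ¬ Im i b :=
  fun hb => hk (h.im_of_rel hb hg)

theorem im_or_im (h : PushoutFacts i f g j) (k : P.Idx) : Im j k ∨ Im g k := by
  rcases h.im_or k with hk | ⟨b, -, y, y', τ, hτ⟩
  · exact Or.inl hk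
  · exact Or.inr hτ.im

theorem injAt (h : PushoutFacts i f g j) {k : P.Idx} (hk : ¬ Im j k) : InjAt g k := by
  rintro b b' y z x τ τ' hx hτ hτ'
  obtain rfl := h.eq_of_rel hτ hτ' (h.not_im_of_rel hk hτ) (h.not_im_of_rel hk hτ')
  obtain ⟨l, x', ρ, hρ⟩ := h.dom b (h.not_im_of_rel hk hτ)
  obtain ⟨rfl, a, σ, -, h₁, h₂⟩ := hτ.unique hρ (left_ne_bot τ hx) le_rfl hτ.le_left
  obtain ⟨-, a', σ', -, h₃, h₄⟩ := hτ'.unique hρ (left_ne_bot τ' hx) le_rfl hτ'.le_left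
  have h₅ : C.Sq τ ρ := sq_of_left_le h₁ h₂ hτ.le_left
  have h₆ : C.Sq τ' ρ := sq_of_left_le h₃ h₄ hτ'.le_left
  exact ⟨rfl, C.sq_unique h₅ h₆⟩

/-- Every index of `P` is hit by `j` or by `g`, and on the image of a morphism the germs of `t` are
recovered from those of the composite by cancelling a horizontal isomorphism. -/
theorem hom_ext (h : PushoutFacts i f g j) {Y : SC C} {t t' : P ⟶ Y}
    (h₁ : g ≫ t = g ≫ t') (h₂ : j ≫ t = j ≫ t') : t = t' := by
  refine SC.hom_ext fun k l y y' τ hy => ?_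
  rcases h.im_or_im k with hk | hk
  · exact ⟨hk.rel_of_comp_eq h₂ hy, hk.rel_of_comp_eq h₂.symm hy⟩
  · exact ⟨hk.rel_of_comp_eq h₁ hy, hk.rel_of_comp_eq h₁.symm hy⟩

theorem comp_iso (h : PushoutFacts i f g j) {P' : SC C} (θ : P ⟶ P') (hθ : IsIso θ) :
    PushoutFacts i f (g ≫ θ) (j ≫ θ) := by
  obtain ⟨h₁, h₂, h₃⟩ := weq_iff.1 (weq_of_isIso hθ)
  -- Both germs are enlarged to whole components onto `P'.elt l`, so that they have a common target
  -- and injectivity applies.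
  have inj : ∀ {k k' l} {y y' z z' : C.Ob} {τ : C.Hor y y'} {τ' : C.Hor z z'},
      Rel θ k l τ → Rel θ k' l τ' → k = k' := by
    intro k k' l y y' z z' τ τ' hτ hτ'
    obtain ⟨x, ρ, hρ, -⟩ := hτ.exists_component
    obtain ⟨x', ρ', hρ', -⟩ := hτ'.exists_component
    exact (h₂ l (P'.elt_ne_bot l) hρ hρ').1
  refine ⟨by rw [← Category.assoc, h.comm, Category.assoc],
    fun x => (h.total x).comp fun k _ _ _ _ => h₁ k, fun l => InjAt.comp h.inj (h₂ l),
    fun l => ?_, fun b hb => ?_, ?_, ?_⟩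
  · obtain ⟨k, y, y', τ, hτ⟩ := h₃ l
    rcases h.im_or k with hk | ⟨b, hb, z, z', ρ, hρ⟩
    · exact Or.inl (hk.comp hτ)
    · obtain ⟨x, σ, hσ, -⟩ := hρ.exists_component
      obtain ⟨v, κ, hκ⟩ := C.exists_sq σ hτ.le_left
      exact Or.inr ⟨b, hb, _, _, _, (hσ.down hκ).comp hτ⟩
  · obtain ⟨k, y', τ, hτ⟩ := h.dom b hb
    obtain ⟨l, z, ρ, hρ⟩ := (dom_elt_of_isIso hθ k).le hτ.le_right
    exact (hτ.comp hρ).dom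
  · rintro b l y y' τ hτ hb ⟨x, z, z', ρ, hρ⟩
    obtain ⟨k, _, _, _, -, h₄, h₅⟩ := hτ.of_comp
    obtain ⟨k', _, _, _, -, h₆, h₇⟩ := hρ.of_comp
    obtain rfl := inj h₅ h₇
    exact h.not_im h₄ hb h₆.im
  · rintro b b' l y y' z z' τ τ' hτ hτ' hb hb'
    obtain ⟨k, _, _, _, -, h₄, h₅⟩ := hτ.of_comp
    obtain ⟨k', _, _, _, -, h₆, h₇⟩ := hτ'.of_comp
    obtain rfl := inj h₅ h₇
    exact h.eq_of_rel h₄ h₆ hb hb'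

end PushoutFacts

end SC

namespace SC

open PolytopeComplex

variable {C : PolytopeComplex.{v, u}}

/-! ### The universal property of the candidate pushout -/

section Desc

variable {A B X P Y : SC C} {Q : Span A B} {S : Span A X} {g : B ⟶ P} {j : X ⟶ P}

/-- For each component of `S` arriving at `x`, the equation `huv` factors the pullback of `y`
through a component of `Q`. These components form a choice, and `y` lies in the piece it cuts out.
-/
theorem IsMaximal.dom (hmax : IsMaximal Q S j) {u : B ⟶ Y} {v : X ⟶ Y}
    (huv : Q.hom ≫ u = S.hom ≫ v) {x : X.Idx} {y : C.Ob} (hy : y ≠ C.bot) (hv : Dom v x y) :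
    Dom j x y := by
  obtain ⟨l, y', τ, hτ⟩ := hv
  have key : ∀ s : {s // S.f s = x}, ∃ k : Q.apex.Idx, Q.p k = S.p s.1 ∧
      PullLe (S.hor s.1) (Q.apex.elt k) y := by
    rintro ⟨s, rfl⟩
    obtain ⟨w, κ, hκ⟩ := C.exists_sq (S.hor s) hτ.le_left
    have h₁ : Rel S.hom (S.p s) (S.f s) κ := ⟨s, rfl, rfl, hκ⟩
    have h₂ := h₁.comp hτ
    rw [← huv] at h₂
    obtain ⟨b, x', τ₁, τ₂, -, ⟨k, hk, -, hk'⟩, -⟩ := h₂.of_comp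
    exact ⟨k, hk, w, κ, hκ, C.sq_left hk'⟩
  choose c hc₁ hc₂ using key
  obtain ⟨m, hm, -⟩ := exists_isPiece (𝟙 C) (fun s : {s // S.f s = x} => S.hor s.1)
    (b₀ := X.elt x) (fun s => by rw [s.2]) (fun s => Q.apex.elt (c s))
    (fun s => ⟨A.elt (S.p s.1), S.sub.le _, by rw [← hc₁]; exact Q.sub.le _⟩)
  have hym : y ≤ m := hm.max y hτ.le_left hc₂
  exact (hmax x c hc₁ m (ne_bot_of_le hym hy) hm).le hym

theorem PushoutFacts.exists_desc (h : PushoutFacts Q.hom S.hom g j) (hmax : IsMaximal Q S j)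
    {u : B ⟶ Y} {v : X ⟶ Y} (huv : Q.hom ≫ u = S.hom ≫ v) :
    ∃ t : P ⟶ Y, g ≫ t = u ∧ j ≫ t = v := by
  obtain ⟨U, rfl⟩ := exists_span u
  obtain ⟨V, rfl⟩ := exists_span v
  have hV : ∀ s : V.apex.Idx, Rel V.hom (V.p s) (V.f s) (V.hor s) :=
    fun s => ⟨s, rfl, rfl, C.sq_vid _⟩
  choose kV yV κV hκV using fun s : V.apex.Idx =>
    hmax.dom huv (V.apex.elt_ne_bot s) (hV s).dom
  choose kU yU κU hκU using fun s : {s : U.apex.Idx // ¬ Im Q.hom (U.p s)} =>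
    (h.dom (U.p s.1) s.2).le (U.sub.le s.1)
  -- Each component of `v` is transported to `P` through `j`, where maximality ensures that it lies
  -- in one component. Components of `u` are transported through `g` only from indices outside the
  -- image of `Q`; the others are forced by commutativity.
  obtain ⟨t, ht⟩ := exists_hom (A := P) (B := Y)
    (I := V.apex.Idx ⊕ {s : U.apex.Idx // ¬ Im Q.hom (U.p s)})
    (Sum.elim yV yU)
    (by
      rintro (s | s)
      · exact right_ne_bot (κV s) (V.apex.elt_ne_bot s)
      · exact right_ne_bot (κU s) (U.apex.elt_ne_bot s.1))
    (Sum.elim kV kU) (Sum.elim V.f fun s => U.f s.1)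
    (fun s => match s with
      | Sum.inl s => C.hcomp (C.hinv (κV s)) (V.hor s)
      | Sum.inr s => C.hcomp (C.hinv (κU s)) (U.hor s.1))
    (by
      rintro (s | s)
      · exact (hκV s).le_right
      · exact (hκU s).le_right)
    (by
      rintro (s | s) (s' | s') w hw hp hws hws' <;>
        simp only [Sum.elim_inl, Sum.elim_inr] at hp hws hws'
      · obtain ⟨x, ρ, hρ⟩ := C.exists_sq (κV s) hws
        have h₁ := hκV s'
        rw [← hp] at h₁
        obtain ⟨h₂, h₃⟩ := (h.inj _).apply_le ((hκV s).down hρ) h₁ hws' hw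
        rw [V.eq_of_le h₂ (left_ne_bot ρ hw) (C.sq_left hρ) (C.sq_left h₃)]
      · exact absurd (hκV s).im (h.not_im (hp ▸ hκU s') s'.2)
      · exact absurd (hκV s').im (h.not_im (hp ▸ hκU s) s.2)
      · obtain ⟨x, ρ, hρ⟩ := C.exists_sq (κU s) hws
        have h₁ := hκU s'
        rw [← hp] at h₁
        obtain ⟨h₂, h₃⟩ := (h.injAt (h.not_im h₁ s'.2)).apply_le ((hκU s).down hρ) h₁ hws' hw
        rw [Subtype.ext (U.eq_of_le h₂ (left_ne_bot ρ hw) (C.sq_left hρ) (C.sq_left h₃))])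
  have ht' : ∀ (k : P.Idx) (l : Y.Idx) (y y' : C.Ob) (τ : C.Hor y y'), Rel t k l τ →
      (∃ (x : X.Idx) (z : C.Ob) (κ : C.Hor z y), Rel j x k κ ∧ Rel V.hom x l (C.hcomp κ τ)) ∨
      (∃ (b : B.Idx) (z : C.Ob) (κ : C.Hor z y), ¬ Im Q.hom b ∧ Rel g b k κ ∧
        Rel U.hom b l (C.hcomp κ τ)) := by
    intro k l y y' τ hτ
    obtain ⟨s | s, rfl, rfl, hs⟩ := (ht k l y y' τ).1 hτ
    · left
      change C.Sq τ (C.hcomp (C.hinv (κV s)) (V.hor s)) at hs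
      obtain ⟨z, κ, hκ⟩ := C.exists_sq (κV s) (C.sq_left hs)
      refine ⟨V.p s, z, κ, (hκV s).down hκ, (hV s).down ?_⟩
      have := C.sq_hcomp hκ hs
      rwa [hcomp_hinv_cancel] at this
    · right
      change C.Sq τ (C.hcomp (C.hinv (κU s)) (U.hor s.1)) at hs
      obtain ⟨z, κ, hκ⟩ := C.exists_sq (κU s) (C.sq_left hs)
      refine ⟨U.p s.1, z, κ, s.2, (hκU s).down hκ, s.1, rfl, rfl, ?_⟩
      have := C.sq_hcomp hκ hs
      rwa [hcomp_hinv_cancel] at this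
  have hj : j ≫ t = V.hom := by
    refine SC.hom_ext fun x l y y' τ hy => ⟨fun hτ => ?_, fun hτ => ?_⟩
    · obtain ⟨k, z, τ₁, τ₂, rfl, h₁, h₂⟩ := hτ.of_comp
      rcases ht' _ _ _ _ _ h₂ with ⟨x', z', κ, h₃, h₄⟩ | ⟨b, z', κ, hb, h₃, h₄⟩
      · obtain ⟨rfl, h₅⟩ := h.inj k (right_ne_bot τ₁ hy) h₁ h₃
        exact h₄.down (C.sq_hcomp h₅ (C.sq_vid _))
      · exact absurd h₁.im (h.not_im h₃ hb)
    · obtain ⟨s, rfl, rfl, hs⟩ := hτ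
      suffices hs' : Rel (j ≫ t) (V.p s) (V.f s) (V.hor s) from hs'.down hs
      rw [← hcomp_hinv_cancel (κV s) (V.hor s)]
      exact (hκV s).comp ((ht _ _ _ _ _).2 ⟨Sum.inl s, rfl, rfl, C.sq_vid _⟩)
  refine ⟨t, ?_, hj⟩
  have hi : Q.hom ≫ g ≫ t = Q.hom ≫ U.hom := by
    rw [huv, ← hj, ← Category.assoc, h.comm, Category.assoc]
  refine SC.hom_ext fun b l y y' τ hy => ?_
  by_cases hb : Im Q.hom b
  · exact ⟨hb.rel_of_comp_eq hi hy, hb.rel_of_comp_eq hi.symm hy⟩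
  refine ⟨fun hτ => ?_, fun hτ => ?_⟩
  · obtain ⟨k, z, τ₁, τ₂, rfl, h₁, h₂⟩ := hτ.of_comp
    rcases ht' _ _ _ _ _ h₂ with ⟨x', z', κ, h₃, h₄⟩ | ⟨b', z', κ, hb', h₃, h₄⟩
    · exact absurd h₃.im (h.not_im h₁ hb)
    · obtain ⟨rfl, h₅⟩ := h.injAt (h.not_im h₁ hb) (right_ne_bot τ₁ hy) h₁ h₃
      exact h₄.down (C.sq_hcomp h₅ (C.sq_vid _))
  · obtain ⟨s, rfl, rfl, hs⟩ := hτ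
    suffices hs' : Rel (g ≫ t) (U.p s) (U.f s) (U.hor s) from hs'.down hs
    rw [← hcomp_hinv_cancel (κU ⟨s, hb⟩) (U.hor s)]
    exact (hκU ⟨s, hb⟩).comp ((ht _ _ _ _ _).2 ⟨Sum.inr ⟨s, hb⟩, rfl, rfl, C.sq_vid _⟩)

theorem PushoutFacts.isPushout (h : PushoutFacts Q.hom S.hom g j) (hmax : IsMaximal Q S j) :
    IsPushout Q.hom S.hom g j := by
  choose t ht₁ ht₂ using fun c : PushoutCocone Q.hom S.hom => h.exists_desc hmax c.condition
  exact ⟨⟨h.comm⟩, ⟨PushoutCocone.IsColimit.mk _ t ht₁ ht₂ fun c m h₁ h₂ =>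
    h.hom_ext (h₁.trans (ht₁ c).symm) (h₂.trans (ht₂ c).symm)⟩⟩

end Desc

/-! ### Existence -/

section Existence

variable {A B X : SC C} (Q : Span A B) (S : Span A X)

/-- The choices of a component of `Q` for every component of `S` over the index `x`. -/
abbrev Choice (x : X.Idx) : Type :=
  {c : {s // S.f s = x} → Q.apex.Idx // ∀ s, Q.p (c s) = S.p s.1}

/-- If no component of `S` arrives at `x`, the only choice is the empty function and the piece is
all of `X.elt x` up to vertical isomorphism. -/
theorem exists_choice_piece (x : X.Idx) (c : Choice Q S x) :
    ∃ m, IsPiece (X.elt x) (fun s : {s // S.f s = x} => S.hor s.1)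
      (fun s => Q.apex.elt (c.1 s)) m := by
  obtain ⟨m, hm, -⟩ := exists_isPiece (𝟙 C) (fun s : {s // S.f s = x} => S.hor s.1)
    (b₀ := X.elt x) (fun s => by rw [s.2]) (fun s => Q.apex.elt (c.1 s))
    (fun s => ⟨A.elt (S.p s.1), S.sub.le _, by rw [← c.2]; exact Q.sub.le _⟩)
  exact ⟨m, hm⟩

/-- The piece cut out by a choice of components. -/
noncomputable def choicePiece (x : X.Idx) (c : Choice Q S x) : C.Ob :=
  (exists_choice_piece Q S x c).choose

theorem isPiece_choicePiece (x : X.Idx) (c : Choice Q S x) :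
    IsPiece (X.elt x) (fun s : {s // S.f s = x} => S.hor s.1) (fun s => Q.apex.elt (c.1 s))
      (choicePiece Q S x c) :=
  (exists_choice_piece Q S x c).choose_spec

/-- The indices of the common refinement. -/
abbrev RefIdx : Type := {z : Σ x, Choice Q S x // choicePiece Q S z.1 z.2 ≠ C.bot}

variable {Q S}

theorem RefIdx.le (z : RefIdx Q S) : choicePiece Q S z.1.1 z.1.2 ≤ X.elt z.1.1 :=
  (isPiece_choicePiece Q S z.1.1 z.1.2).le

/-- The pullback of `w` along a component `s` of `S` is a polytope lying in both chosen components
of `Q` over `S.p s`, so the choices agree at every `s`. -/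
theorem RefIdx.ext_of_le {z z' : RefIdx Q S} (h : z.1.1 = z'.1.1) {w : C.Ob} (hw : w ≠ C.bot)
    (h₁ : w ≤ choicePiece Q S z.1.1 z.1.2) (h₂ : w ≤ choicePiece Q S z'.1.1 z'.1.2) : z = z' := by
  obtain ⟨⟨x, c⟩, hz⟩ := z
  obtain ⟨⟨x', c'⟩, hz'⟩ := z'
  dsimp only at h h₁ h₂
  subst h
  suffices hc : c = c' by subst hc; rfl
  refine Subtype.ext (funext fun s => ?_)
  obtain ⟨v, κ, h₃, h₄⟩ := ((isPiece_choicePiece Q S x c).pullLe s).le h₁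
  obtain ⟨v', κ', h₅, h₆⟩ := ((isPiece_choicePiece Q S x c').pullLe s).le h₂
  exact Q.eq_of_le (by rw [c.2, c'.2]) (left_ne_bot κ hw) h₄
    ((C.sq_left (C.sq_unique h₃ h₅)).trans h₆)

variable (Q S)

/-- For each component of `S` over `x`, the covering by components of `Q` is moved to `X.elt x`
along the inverse horizontal morphism. Finitely many such coverings have a common refinement, each
polytope of which determines a choice. -/
theorem cov_choicePiece (hQ : ∀ a, TotalAt Q.hom a) (x : X.Idx) :
    Cov (X.elt x) (fun y => ∃ z : RefIdx Q S, z.1.1 = x ∧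
      y ≤ choicePiece Q S z.1.1 z.1.2) := by
  refine Cov.of_ne_bot (X.elt_ne_bot x) (fun b c hbc ⟨z, h₁, h₂⟩ => ⟨z, h₁, hbc.trans h₂⟩) ?_
  have key : ∀ s : {s // S.f s = x}, Cov (X.elt x) (fun y => ∃ k : Q.apex.Idx,
      Q.p k = S.p s.1 ∧ PullLe (S.hor s.1) (Q.apex.elt k) y) := by
    rintro ⟨s, rfl⟩
    refine (((hQ (S.p s)).le (S.sub.le s)).pull (C.hinv (S.hor s))).mono ?_
    rintro y - ⟨w, κ, hκ, z, hz, b, z', ρ, k, h₁, h₂, h₃⟩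
    refine ⟨k, h₁, w, C.hinv κ, ?_, hz.trans (C.sq_left h₃)⟩
    have := sq_inv hκ
    rwa [hinv_hinv] at this
  refine (Cov.forall_of_finite key).mono fun y hy h hne => ?_
  choose c hc₁ hc₂ using h
  have hle := (isPiece_choicePiece Q S x ⟨c, hc₁⟩).max y hy hc₂
  exact ⟨⟨⟨x, ⟨c, hc₁⟩⟩, ne_bot_of_le hle hne⟩, rfl, hle⟩

theorem exists_pushout (hQ : ∀ a, TotalAt Q.hom a) (hQ' : Function.Injective Q.f) :
    ∃ (P : SC C) (g : B ⟶ P) (j : X ⟶ P), PushoutFacts Q.hom S.hom g j ∧ IsMaximal Q S j := by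
  obtain ⟨P, e, he⟩ := exists_obj (C := C) (I := RefIdx Q S ⊕ {b : B.Idx // ¬ Im Q.hom b})
    (Sum.elim (fun z => choicePiece Q S z.1.1 z.1.2) (fun b => B.elt b.1))
    (by
      rintro (z | b)
      · exact z.2
      · exact B.elt_ne_bot b.1)
  have heZ : ∀ z, P.elt (e.symm (Sum.inl z)) = choicePiece Q S z.1.1 z.1.2 := fun z => by
    rw [he, Equiv.apply_symm_apply]; rfl
  have heW : ∀ b, P.elt (e.symm (Sum.inr b)) = B.elt b.1 := fun b => by
    rw [he, Equiv.apply_symm_apply]; rfl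
  obtain ⟨j, hj⟩ := exists_hom (A := X) (B := P) (I := RefIdx Q S)
    (fun z => P.elt (e.symm (Sum.inl z))) (fun z => P.elt_ne_bot _) (fun z => z.1.1)
    (fun z => e.symm (Sum.inl z)) (fun z => C.hid _) (fun z => by rw [heZ]; exact z.le)
    (fun z z' w hw h h₁ h₂ => RefIdx.ext_of_le h hw (by rwa [heZ] at h₁) (by rwa [heZ] at h₂))
  -- the overlaps of the components of `S` with the pieces
  have key : ∀ q : {q : S.apex.Idx × RefIdx Q S // S.f q.1 = q.2.1.1},
      ∃ (k : Q.apex.Idx) (v v' : C.Ob) (α : C.Hor v (P.elt (e.symm (Sum.inl q.1.2))))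
        (β : C.Hor v v'), Q.p k = S.p q.1.1 ∧ C.Sq α (S.hor q.1.1) ∧ C.Sq β (Q.hor k) := by
    rintro ⟨⟨s, z⟩, hs⟩
    obtain ⟨v, α, h₁, h₂⟩ := (isPiece_choicePiece Q S z.1.1 z.1.2).pullLe ⟨s, hs⟩
    obtain ⟨v', β, hβ⟩ := exists_push (Q.hor (z.1.2.1 ⟨s, hs⟩)) h₂
    dsimp only
    rw [heZ]
    exact ⟨_, v, v', α, β, z.1.2.2 _, h₁, hβ⟩
  choose k v v' α β hk hα hβ using key
  -- On the image of `Q`, `g` undoes `β` and then applies `α`, going back from `B` to the overlap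
  -- inside `A` and on to the piece. Elsewhere it is the identity.
  obtain ⟨g, hg⟩ := exists_hom (A := B) (B := P)
    (I := {q : S.apex.Idx × RefIdx Q S // S.f q.1 = q.2.1.1} ⊕ {b : B.Idx // ¬ Im Q.hom b})
    (Sum.elim v' fun b => P.elt (e.symm (Sum.inr b)))
    (by
      rintro (q | b)
      · exact right_ne_bot (β q) (left_ne_bot (α q) (P.elt_ne_bot _))
      · exact P.elt_ne_bot _)
    (Sum.elim (fun q => Q.f (k q)) fun b => b.1)
    (Sum.elim (fun q => e.symm (Sum.inl q.1.2)) fun b => e.symm (Sum.inr b))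
    (fun q => match q with
      | Sum.inl q => C.hcomp (C.hinv (β q)) (α q)
      | Sum.inr b => C.hid _)
    (by
      rintro (q | b)
      · exact C.sq_right (hβ q)
      · exact (heW b).le)
    (by
      have him : ∀ k, Im Q.hom (Q.f k) := fun k => (Q.im_iff _).2 ⟨k, rfl⟩
      rintro (q | b) (q' | b') w hw hp h₁ h₂ <;>
        simp only [Sum.elim_inl, Sum.elim_inr] at hp h₁ h₂
      -- Injectivity of `Q` moves the overlap back into a single member of `A`. There disjointness
      -- of `S` identifies the components, and disjointness of the pieces identifies the rest of the
      -- index.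
      · have hkk : k q = k q' := hQ' hp
        obtain ⟨x, ρ, hρ⟩ := C.exists_sq (β q) h₁
        obtain ⟨x', ρ', hρ'⟩ := C.exists_sq (β q') h₂
        have hxne := left_ne_bot ρ hw
        have hβ' := C.sq_vcomp hρ' (hβ q')
        rw [← hkk] at hβ'
        have h₃ : x ≤ x' := C.sq_left (C.sq_unique (C.sq_vcomp hρ (hβ q)) hβ')
        have h₄ : q.1.1 = q'.1.1 := S.eq_of_le (by rw [← hk, ← hk, hkk]) hxne
          ((C.sq_left hρ).trans (C.sq_left (hα q)))
          ((h₃.trans (C.sq_left hρ')).trans (C.sq_left (hα q')))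
        have hα' := hα q'
        rw [← h₄] at hα'
        obtain ⟨m, μ, hμ⟩ := exists_push (α q) (C.sq_left hρ)
        have h₅ := C.sq_right (sq_of_left_le (C.sq_vcomp hμ (hα q)) hα'
          (h₃.trans (C.sq_left hρ')))
        have h₆ : q.1.2 = q'.1.2 := RefIdx.ext_of_le (by rw [← q.2, ← q'.2, h₄])
          (right_ne_bot μ hxne) (by rw [← heZ]; exact C.sq_right hμ) (by rwa [← heZ])
        exact congrArg Sum.inl (Subtype.ext (Prod.ext h₄ h₆))
      · exact absurd (hp ▸ him _) b'.2
      · exact absurd (hp ▸ him _) b.2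
      · exact congrArg Sum.inr (Subtype.ext hp))
  have himj : ∀ l, Im j l ↔ ∃ z, e.symm (Sum.inl z) = l := by
    intro l
    constructor
    · rintro ⟨x, y, y', τ, hτ⟩
      obtain ⟨z, -, h, -⟩ := (hj _ _ _ _ _).1 hτ
      exact ⟨z, h⟩
    · rintro ⟨z, rfl⟩
      exact ⟨_, _, _, _, (hj _ _ _ _ _).2 ⟨z, rfl, rfl, C.sq_vid _⟩⟩
  have hgW : ∀ {b l} {y y' : C.Ob} {τ : C.Hor y y'}, Rel g b l τ → ¬ Im Q.hom b →
      ∃ hb : ¬ Im Q.hom b, e.symm (Sum.inr ⟨b, hb⟩) = l := by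
    intro b l y y' τ hτ hb
    obtain ⟨q | b', rfl, h₁, -⟩ := (hg _ _ _ _ _).1 hτ
    · exact absurd ((Q.im_iff _).2 ⟨_, rfl⟩) hb
    · exact ⟨hb, h₁⟩
  refine ⟨P, g, j, ⟨?_, fun x => ?_, fun l => ?_, fun l => ?_, fun b hb => ?_, ?_, ?_⟩, ?_⟩
  · refine SC.hom_ext fun a l y y' τ hy => ⟨fun hτ => ?_, fun hτ => ?_⟩
    · obtain ⟨b, x, τ₁, τ₂, rfl, ⟨k₀, rfl, rfl, h₁⟩, h₂⟩ := hτ.of_comp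
      obtain ⟨q | b', h₃, rfl, h₄⟩ := (hg _ _ _ _ _).1 h₂
      · have hkk : k q = k₀ := hQ' h₃
        subst hkk
        change C.Sq τ₂ (C.hcomp (C.hinv (β q)) (α q)) at h₄
        have h₅ : C.Sq τ₁ (β q) := sq_mono h₁ (hβ q) (C.sq_left h₄)
        have h₆ := C.sq_hcomp h₅ h₄
        rw [hcomp_hinv_cancel] at h₆
        have h₇ : Rel S.hom (Q.p (k q)) q.1.2.1.1 (α q) := ⟨q.1.1, (hk q).symm, q.2, hα q⟩
        have h₈ : Rel j q.1.2.1.1 (e.symm (Sum.inl q.1.2)) (C.hid _) :=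
          (hj _ _ _ _ _).2 ⟨q.1.2, rfl, rfl, C.sq_vid _⟩
        have h₉ := h₇.comp h₈
        rw [C.hcomp_id] at h₉
        exact h₉.down h₆
      · exact absurd ((Q.im_iff _).2 ⟨_, h₃.symm⟩) b'.2
    · obtain ⟨x, m, τ₁, τ₂, rfl, ⟨s, rfl, rfl, h₁⟩, h₂⟩ := hτ.of_comp
      obtain ⟨z, h₃, rfl, h₄⟩ := (hj _ _ _ _ _).1 h₂
      have h₅ : C.Sq τ₁ (α ⟨(s, z), h₃.symm⟩) := sq_mono h₁ (hα _) (C.sq_left h₄)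
      have h₆ := C.sq_hcomp h₅ h₄
      rw [C.hcomp_id] at h₆
      refine Rel.down ?_ h₆
      rw [← hcomp_hinv_cancel (β ⟨(s, z), h₃.symm⟩) (α _)]
      refine Rel.comp (j := Q.f (k ⟨(s, z), h₃.symm⟩)) ⟨_, hk _, rfl, hβ _⟩ ?_
      exact (hg _ _ _ _ _).2 ⟨Sum.inl ⟨(s, z), h₃.symm⟩, rfl, rfl, C.sq_vid _⟩
  · refine (cov_choicePiece Q S hQ x).mono ?_
    rintro y - ⟨z, rfl, h⟩
    rw [← heZ] at h
    exact Dom.le (Rel.dom ((hj _ _ _ _ _).2 ⟨z, rfl, rfl, C.sq_vid _⟩)) h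
  · rintro x x' y z m τ τ' hm h h'
    obtain ⟨z, rfl, rfl, h₁⟩ := (hj _ _ _ _ _).1 h
    obtain ⟨z', rfl, h₂, h₃⟩ := (hj _ _ _ _ _).1 h'
    obtain rfl := Sum.inl_injective (e.symm.injective h₂)
    exact ⟨rfl, C.sq_unique h₁ h₃⟩
  · obtain ⟨z | b, rfl⟩ := e.symm.surjective l
    · exact Or.inl ((himj _).2 ⟨z, rfl⟩)
    · exact Or.inr ⟨b.1, b.2, _, _, _, (hg _ _ _ _ _).2 ⟨Sum.inr b, rfl, rfl, C.sq_vid _⟩⟩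
  · exact Dom.le (Rel.dom ((hg _ _ _ _ _).2 ⟨Sum.inr ⟨b, hb⟩, rfl, rfl, C.sq_vid _⟩))
      (heW ⟨b, hb⟩).ge
  · intro b l y y' τ hτ hb hl
    obtain ⟨z, hz⟩ := (himj l).1 hl
    obtain ⟨hb', h⟩ := hgW hτ hb
    exact Sum.inl_ne_inr (e.symm.injective (hz.trans h.symm))
  · intro b b' l y y' z z' τ τ' hτ hτ' hb hb'
    obtain ⟨h₁, h₂⟩ := hgW hτ hb
    obtain ⟨h₃, h₄⟩ := hgW hτ' hb'
    exact congrArg Subtype.val (Sum.inr_injective (e.symm.injective (h₂.trans h₄.symm)))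
  · intro x c hc m hm hpiece
    have hle := (isPiece_choicePiece Q S x ⟨c, hc⟩).max m hpiece.le hpiece.pullLe
    refine Dom.le (Rel.dom ((hj _ _ _ _ _).2
      ⟨⟨⟨x, ⟨c, hc⟩⟩, ne_bot_of_le hle hm⟩, rfl, rfl, C.sq_vid _⟩)) ?_
    rw [heZ]
    exact hle

end Existence

end SC

namespace SC

open PolytopeComplex

variable {C : PolytopeComplex.{v, u}}

/-- Any pushout is isomorphic to the constructed one, and the facts survive composition with an
isomorphism. -/
theorem PushoutFacts.of_isPushout {A B X P : SC C} {i : A ⟶ B} {f : A ⟶ X} {g : B ⟶ P}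
    {j : X ⟶ P} (h : IsPushout i f g j) (hi : cof C i) : PushoutFacts i f g j := by
  obtain ⟨h₁, h₂⟩ := cof_iff.1 hi
  obtain ⟨Q, rfl⟩ := exists_span i
  obtain ⟨S, rfl⟩ := exists_span f
  obtain ⟨P₀, g₀, j₀, h₃, h₄⟩ := exists_pushout Q S h₁ (Q.injective_iff.2 h₂)
  have h₅ := h₃.comp_iso (IsPushout.isoIsPushout _ _ (h₃.isPushout h₄) h).hom inferInstance
  rwa [IsPushout.inl_isoIsPushout_hom, IsPushout.inr_isoIsPushout_hom] at h₅

theorem PushoutFacts.totalAt {A B X P : SC C} {i : A ⟶ B} {f : A ⟶ X} {g : B ⟶ P}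
    {j : X ⟶ P} (h : PushoutFacts i f g j) {b : B.Idx} (hb : ¬ Im i b) : TotalAt g b :=
  Cov.of_forall fun _ hy => (h.dom b hb).le hy

/-! ## The gluing axiom -/

/-- Under weak equivalences `A → A'` and `B → B'`, an index of `B` mapping into the image of `A'`
comes from `A`. -/
theorem im_of_rel_of_im {A B A' B' : SC C} {i : A ⟶ B} {i' : A' ⟶ B'} {a : A ⟶ A'} {b : B ⟶ B'}
    (hib : i ≫ b = a ≫ i') (ha : ∀ k, Im a k) (hb : ∀ k, InjAt b k) {β : B.Idx} {β' : B'.Idx}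
    {y y' : C.Ob} {τ : C.Hor y y'} (hτ : Rel b β β' τ) (hβ' : Im i' β') : Im i β := by
  obtain ⟨x, ρ, hρ, -⟩ := hτ.exists_component
  obtain ⟨α', z, κ, hκ⟩ := hβ'.exists_rel le_rfl
  obtain ⟨α, z', κ', hκ'⟩ := (ha α').exists_rel hκ.le_left
  have h := hκ'.comp hκ
  rw [← hib] at h
  obtain ⟨β₁, w, σ₁, σ₂, -, h₁, h₂⟩ := h.of_comp
  obtain ⟨rfl, -⟩ := hb β' (B'.elt_ne_bot β') hρ h₂
  exact h₁.im

/-- The map `t` respects the division of indices into the image of `X` and its complement. On the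
image its properties descend from `x`, on the complement from `b`. -/
theorem gluing {A B X P A' B' X' P' : SC C} {i : A ⟶ B} {f : A ⟶ X} {g : B ⟶ P} {j : X ⟶ P}
    {i' : A' ⟶ B'} {f' : A' ⟶ X'} {g' : B' ⟶ P'} {j' : X' ⟶ P'}
    {a : A ⟶ A'} {b : B ⟶ B'} {x : X ⟶ X'} {t : P ⟶ P'}
    (h : PushoutFacts i f g j) (h' : PushoutFacts i' f' g' j')
    (hib : i ≫ b = a ≫ i') (hgt : g ≫ t = b ≫ g') (hjt : j ≫ t = x ≫ j')
    (ha : weq C a) (hb : weq C b) (hx : weq C x) : weq C t := by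
  rw [weq_iff] at ha hb hx ⊢
  obtain ⟨-, -, ha⟩ := ha
  obtain ⟨hb₁, hb₂, hb₃⟩ := hb
  obtain ⟨hx₁, hx₂, hx₃⟩ := hx
  have him : ∀ {k l} {y y' : C.Ob} {τ : C.Hor y y'}, Rel t k l τ → (Im j k ↔ Im j' l) := by
    intro k l y y' τ hτ
    constructor
    · intro hk
      have := hk.comp hτ
      rw [hjt] at this
      exact this.of_comp
    · intro hl
      by_contra hk
      obtain ⟨β, y₀, σ, hσ⟩ := ((h.im_or_im k).resolve_left hk).exists_rel hτ.le_left
      have h₁ := hσ.comp hτ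
      rw [hgt] at h₁
      obtain ⟨β', w, σ₁, σ₂, -, h₂, h₃⟩ := h₁.of_comp
      refine h'.not_im h₃ (fun hβ' => ?_) hl
      exact h.not_im_of_rel hk hσ (im_of_rel_of_im hib ha hb₂ h₂ hβ')
  refine ⟨fun k => ?_, fun l k k' y z w τ τ' hw hτ hτ' => ?_, fun l => ?_⟩
  · by_cases hk : Im j k
    · refine TotalAt.of_comp_of_im (fun ξ _ _ _ _ => ?_) hk
      rw [hjt]
      exact (hx₁ ξ).comp fun ξ' _ _ _ _ => h'.total ξ'
    · refine TotalAt.of_comp_of_im (fun β _ _ τ hτ => ?_) ((h.im_or_im k).resolve_left hk)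
      rw [hgt]
      exact (hb₁ β).comp fun β' _ _ _ hρ => h'.totalAt fun hβ' =>
        h.not_im_of_rel hk hτ (im_of_rel_of_im hib ha hb₂ hρ hβ')
  · by_cases hl : Im j' l
    · refine InjAt.of_comp_of_im (φ := j) ?_ ((him hτ).2 hl) ((him hτ').2 hl) hw hτ hτ'
      rw [hjt]
      exact InjAt.comp hx₂ (h'.inj l)
    · refine InjAt.of_comp_of_im (φ := g) ?_ ((h.im_or_im k).resolve_left (mt (him hτ).1 hl))
        ((h.im_or_im k').resolve_left (mt (him hτ').1 hl)) hw hτ hτ'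
      rw [hgt]
      exact InjAt.comp hb₂ (h'.injAt hl)
  · rcases h'.im_or_im l with hl | hl
    · obtain ⟨ξ', y, y', τ, hτ⟩ := hl
      have := (hx₃ ξ').comp hτ
      rw [← hjt] at this
      exact this.of_comp
    · obtain ⟨β', y, y', τ, hτ⟩ := hl
      have := (hb₃ β').comp hτ
      rw [← hgt] at this
      exact this.of_comp

theorem isWaldhausen (C : PolytopeComplex.{v, u}) : IsWaldhausen (cof C) (weq C) where
  hasZero := ⟨⟨empty C, isZero_empty C⟩⟩
  co_mul :=
    { id_mem := fun _ => cof_of_weq (weq_of_isIso inferInstance)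
      comp_mem := fun _ _ => cof_comp }
  w_mul :=
    { id_mem := fun _ => weq_of_isIso inferInstance
      comp_mem := fun _ _ => weq_comp }
  co_of_iso _ h := cof_of_weq (weq_of_isIso h)
  w_of_iso _ h := weq_of_isIso h
  co_of_zero f h := cof_of_isZero h f
  hasPushout i f hi := by
    obtain ⟨h₁, h₂⟩ := cof_iff.1 hi
    obtain ⟨Q, rfl⟩ := exists_span i
    obtain ⟨S, rfl⟩ := exists_span f
    obtain ⟨P, g, j, h₃, h₄⟩ := exists_pushout Q S h₁ (Q.injective_iff.2 h₂)
    exact (h₃.isPushout h₄).hasPushout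
  co_pushout h hi := by
    have := PushoutFacts.of_isPushout h hi
    exact cof_iff.2 ⟨this.total, this.inj⟩
  gluing h h' hi hi' hib _ hgt hjt ha hb hx :=
    gluing (.of_isPushout h hi) (.of_isPushout h' hi') hib hgt hjt ha hb hx

/-! ## Cofibration sequences -/

/-- The description of the cofiber of a cofibration. -/
structure CofiberFacts {A B Q : SC C} (i : A ⟶ B) (q : B ⟶ Q) : Prop where
  im : ∀ k, Im q k
  dom : ∀ b, ¬ Im i b → Dom q b (B.elt b)
  not_im : ∀ {b k} {y y' : C.Ob} {τ : C.Hor y y'}, Rel q b k τ → ¬ Im i b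
  inj : ∀ k, InjAt q k

theorem CofiberFacts.of_isCofibrationSequence {A B Q : SC C} {i : A ⟶ B} {q : B ⟶ Q}
    (h : IsCofibrationSequence (cof C) i q) : CofiberFacts i q := by
  obtain ⟨Z, f, g, hZ, hp⟩ := h.cofiber
  have := isEmpty_of_isZero hZ
  have hg : ∀ k, ¬ Im g k := fun k ⟨z, _⟩ => isEmptyElim z
  have hf := PushoutFacts.of_isPushout hp h.co
  exact ⟨fun k => (hf.im_or_im k).resolve_left (hg k), hf.dom,
    fun hτ => hf.not_im_of_rel (hg _) hτ, fun k => hf.injAt (hg k)⟩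

theorem extensionAxiom (C : PolytopeComplex.{v, u}) : ExtensionAxiom (cof C) (weq C) := by
  intro A B Q A' B' Q' i q i' q' a b c h h' hib hqc ha hc
  have hq := CofiberFacts.of_isCofibrationSequence h
  have hq' := CofiberFacts.of_isCofibrationSequence h'
  obtain ⟨hi'₁, hi'₂⟩ := cof_iff.1 h'.co
  rw [weq_iff] at ha hc ⊢
  obtain ⟨ha₁, ha₂, ha₃⟩ := ha
  obtain ⟨hc₁, hc₂, hc₃⟩ := hc
  have htot : ∀ β, ¬ Im i β → TotalAt (b ≫ q') β := by
    intro β hβ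
    rw [← hqc]
    exact TotalAt.comp (Cov.of_forall fun y hy => (hq.dom β hβ).le hy) fun k _ _ _ _ => hc₁ k
  have htot' : ∀ α, TotalAt (i ≫ b) α := by
    intro α
    rw [hib]
    exact (ha₁ α).comp fun α' _ _ _ _ => hi'₁ α'
  -- Backwards: for `β` outside the image of `i`, the composite `b ≫ q'` is total at `β`. Hence `q'`
  -- is defined on a polytope below `B'.elt γ`, which excludes `γ` from the image of `i'`.
  have him : ∀ {β γ} {y y' : C.Ob} {τ : C.Hor y y'}, Rel b β γ τ → (Im i β ↔ Im i' γ) := by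
    intro β γ y y' τ hτ
    constructor
    · intro hβ
      have := hβ.comp hτ
      rw [hib] at this
      exact this.of_comp
    · intro hγ
      by_contra hβ
      obtain ⟨z, ρ, hρ, -⟩ := hτ.exists_component
      obtain ⟨w, hw, hw', l, w', κ, hκ⟩ := (Cov.le (htot β hβ) hρ.le_left).exists_ne_bot
        (left_ne_bot ρ (B'.elt_ne_bot γ))
      obtain ⟨γ', x, κ₁, κ₂, -, h₁, h₂⟩ := hκ.of_comp
      obtain ⟨rfl, -⟩ := hρ.unique h₁ hw' hw le_rfl
      exact hq'.not_im h₂ hγ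
  refine ⟨fun β => ?_, fun γ β β' y z w τ τ' hw hτ hτ' => ?_, fun γ => ?_⟩
  · by_cases hβ : Im i β
    · exact TotalAt.of_comp_of_im (fun α _ _ _ _ => htot' α) hβ
    · exact (htot β hβ).of_comp
  · by_cases hγ : Im i' γ
    · refine InjAt.of_comp_of_im (φ := i) ?_ ((him hτ).2 hγ) ((him hτ').2 hγ) hw hτ hτ'
      rw [hib]
      exact InjAt.comp ha₂ (hi'₂ γ)
    · obtain ⟨l, w', κ, hκ⟩ := (hq'.dom γ hγ).le hτ.le_right
      have hinj : InjAt (b ≫ q') l := by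
        rw [← hqc]
        exact InjAt.comp hq.inj (hc₂ l)
      obtain ⟨h₁, h₂⟩ := hinj (right_ne_bot κ hw) (hτ.comp hκ) (hτ'.comp hκ)
      refine ⟨h₁, ?_⟩
      have := C.sq_hcomp h₂ (C.sq_vid (C.hinv κ))
      rwa [C.hassoc, C.hassoc, C.hcomp_inv, C.hcomp_id, C.hcomp_id] at this
  · by_cases hγ : Im i' γ
    · obtain ⟨α', y, y', τ, hτ⟩ := hγ
      have := (ha₃ α').comp hτ
      rw [← hib] at this
      exact this.of_comp
    · obtain ⟨l, y', τ, hτ⟩ := hq'.dom γ hγ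
      obtain ⟨k, z, ρ, hρ⟩ := (hc₃ l).exists_rel hτ.le_right
      obtain ⟨β, z', κ, hκ⟩ := (hq.im k).exists_rel hρ.le_left
      have h₁ := hκ.comp hρ
      rw [hqc] at h₁
      obtain ⟨γ', x, σ₁, σ₂, -, h₂, h₃⟩ := h₁.of_comp
      obtain ⟨rfl, -⟩ := hq'.inj l (right_ne_bot τ (B'.elt_ne_bot γ)) h₃ hτ
      exact h₂.im

/-! ## Canonical splittings -/

/-- The components of `s` are the inverses of the components of `q`. -/
def IsReverse {B Q : SC C} (q : B ⟶ Q) (s : Q ⟶ B) : Prop :=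
  ∀ (k : Q.Idx) (b : B.Idx) (y y' : C.Ob) (τ : C.Hor y y'), Rel s k b τ ↔ Rel q b k (C.hinv τ)

theorem CofiberFacts.exists_section {A B Q : SC C} {i : A ⟶ B} {q : B ⟶ Q}
    (h : CofiberFacts i q) :
    ∃ s : Q ⟶ B, IsReverse q s := by
  obtain ⟨T, rfl⟩ := exists_span q
  have hT : Function.Injective T.f := T.injective_iff.2 h.inj
  -- Each component of the quotient map is a whole member of `B`, so its inverse reaches all of
  -- `B.elt (T.p t)`.
  have hle : ∀ t, B.elt (T.p t) ≤ T.apex.elt t := by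
    intro t
    obtain ⟨k, y', τ, t', h₁, -, h₂⟩ := h.dom (T.p t)
      (h.not_im (τ := T.hor t) ⟨t, rfl, rfl, C.sq_vid _⟩)
    obtain rfl : t' = t := T.eq_of_le h₁ (T.apex.elt_ne_bot t)
      ((T.sub.le t).trans (C.sq_left h₂)) le_rfl
    exact C.sq_left h₂
  choose x κ hκ using fun t => C.exists_sq (C.hinv (T.hor t)) (hle t)
  obtain ⟨s, hs⟩ := exists_hom (A := Q) (B := B) x
    (fun t => left_ne_bot (κ t) (B.elt_ne_bot _)) T.f T.p κ (fun t => C.sq_left (hκ t))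
    (fun t t' _ _ h _ _ => hT h)
  refine ⟨s, fun k b y y' τ => (hs _ _ _ _ _).trans ⟨?_, ?_⟩⟩
  · rintro ⟨t, rfl, rfl, h₁⟩
    refine ⟨t, rfl, rfl, ?_⟩
    have := sq_inv (C.sq_vcomp h₁ (hκ t))
    rwa [hinv_hinv] at this
  · rintro ⟨t, rfl, rfl, h₁⟩
    have := sq_inv h₁
    rw [hinv_hinv] at this
    exact ⟨t, rfl, rfl, sq_mono this (hκ t) ((C.sq_left h₁).trans (T.sub.le t))⟩

section

variable {A B Q : SC C} {i : A ⟶ B} {q : B ⟶ Q} {s : Q ⟶ B}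

theorem CofiberFacts.reverse_comp (hq : CofiberFacts i q) (hs : IsReverse q s) : s ≫ q = 𝟙 Q := by
  refine hom_ext fun k l y y' τ hy => ⟨fun hτ => ?_, fun hτ => ?_⟩
  · obtain ⟨b, x, τ₁, τ₂, rfl, h₁, h₂⟩ := hτ.of_comp
    have h₃ := (hs _ _ _ _ _).1 h₁
    obtain ⟨rfl, h₄, -⟩ := h₂.unique_source h₃ (right_ne_bot τ₁ hy)
    refine rel_id_iff.2 ⟨rfl, ?_⟩
    have := C.sq_hcomp (C.sq_vid τ₁) h₄
    rw [C.hcomp_inv] at this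
    exact C.sq_vcomp this (C.sq_hid h₃.le_right)
  · obtain ⟨rfl, h₁⟩ := rel_id_iff.1 hτ
    obtain ⟨b, z, ρ, hρ⟩ := (hq.im k).exists_rel le_rfl
    have h₂ : Rel s k b (C.hinv ρ) := (hs _ _ _ _ _).2 (by rwa [hinv_hinv])
    have h₃ := h₂.comp hρ
    rw [C.hinv_comp] at h₃
    exact h₃.down h₁

theorem CofiberFacts.im_reverse_iff (hq : CofiberFacts i q) (hs : IsReverse q s) (b : B.Idx) :
    Im s b ↔ ¬ Im i b := by
  constructor
  · rintro ⟨k, y, y', τ, hτ⟩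
    exact hq.not_im ((hs _ _ _ _ _).1 hτ)
  · intro hb
    obtain ⟨k, y', τ, hτ⟩ := hq.dom b hb
    exact ((hs k b _ _ (C.hinv τ)).2 (by rwa [hinv_hinv])).im

theorem IsReverse.injAt (hs : IsReverse q s) (b : B.Idx) : InjAt s b := by
  intro k k' y z x τ τ' hx hτ hτ'
  obtain ⟨h₁, h₂, -⟩ := ((hs _ _ _ _ _).1 hτ).unique_source ((hs _ _ _ _ _).1 hτ') hx
  refine ⟨h₁, ?_⟩
  have := sq_inv h₂
  rwa [hinv_hinv, hinv_hinv] at this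

theorem CofiberFacts.cof_reverse (hq : CofiberFacts i q) (hs : IsReverse q s) : cof C s :=
  cof_iff.2 ⟨fun k => TotalAt.of_comp (ψ := q) (hq.reverse_comp hs ▸ totalAt_id k), hs.injAt⟩

end

theorem hasCanonicalSplittings (C : PolytopeComplex.{v, u}) :
    HasCanonicalSplittings (cof C) (weq C) := by
  intro A B Q i q h
  have hq := CofiberFacts.of_isCofibrationSequence h
  obtain ⟨hi₁, hi₂⟩ := cof_iff.1 h.co
  obtain ⟨s, hs⟩ := hq.exists_section
  have hsq := hq.reverse_comp hs
  have hsim := hq.im_reverse_iff hs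
  obtain ⟨hstot, hsinj⟩ := cof_iff.1 (hq.cof_reverse hs)
  refine ⟨s, hsq, fun s' hs' => ?_, cof_iff.2 ⟨hstot, hsinj⟩, fun c hc => ?_⟩
  -- A germ of the identity factors as a germ of `s'` followed by one of `q`; their composite being
  -- an identity, the second is the inverse of the first.
  · have key : ∀ (k : Q.Idx) (y : C.Ob), y ≤ Q.elt k →
        ∃ (b : B.Idx) (x : C.Ob) (τ : C.Hor y x), Rel s' k b τ ∧ Rel q b k (C.hinv τ) := by
      intro k y hy
      have h₁ : Rel (s' ≫ q) k k (C.hid y) := hs' ▸ rel_id_hid hy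
      obtain ⟨b, x, τ₁, τ₂, h₂, h₃, h₄⟩ := h₁.of_comp
      refine ⟨b, x, τ₁, h₃, ?_⟩
      rwa [← C.hcomp_id (C.hinv τ₁), ← h₂, hinv_hcomp_cancel]
    refine hom_ext fun k b y y' τ hy => ⟨fun hτ => ?_, fun hτ => ?_⟩
    · obtain ⟨b₁, x, τ₁, h₁, h₂⟩ := key k y hτ.le_left
      obtain ⟨rfl, h₃, -⟩ := hτ.unique_source h₁ hy
      exact (hs _ _ _ _ _).2 (h₂.down (sq_inv h₃))
    · obtain ⟨b₁, x, τ₁, h₁, h₂⟩ := key k y hτ.le_left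
      obtain ⟨rfl, h₃⟩ := hq.inj k hy ((hs _ _ _ _ _).1 hτ) h₂
      have := sq_inv h₃
      rw [hinv_hinv, hinv_hinv] at this
      exact h₁.down this
  -- The coproduct is a pushout along a cofibration from the zero object, so its indices come from
  -- `A` or from `Q`.
  · obtain ⟨z, z', hp⟩ : ∃ (z : empty C ⟶ A) (z' : empty C ⟶ Q),
        PushoutFacts z z' c.inl c.inr :=
      ⟨_, _, .of_isPushout (IsPushout.of_is_coproduct hc (isZero_empty C).isInitial)
        (cof_of_isZero (isZero_empty C) _)⟩
    have h₁ : c.inl ≫ BinaryCofan.IsColimit.desc hc i s = i :=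
      BinaryCofan.IsColimit.inl_desc hc i s
    have h₂ : c.inr ≫ BinaryCofan.IsColimit.desc hc i s = s :=
      BinaryCofan.IsColimit.inr_desc hc i s
    generalize BinaryCofan.IsColimit.desc hc i s = d at h₁ h₂ ⊢
    have himl : ∀ {t b} {y y' : C.Ob} {τ : C.Hor y y'}, Rel d t b τ → Im c.inl t → Im i b :=
      fun hτ ht => h₁ ▸ ht.comp hτ
    have himr : ∀ {t b} {y y' : C.Ob} {τ : C.Hor y y'}, Rel d t b τ → Im c.inr t → Im s b :=
      fun hτ ht => h₂ ▸ ht.comp hτ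
    refine weq_iff.2 ⟨fun t => ?_, fun b t t' y z x τ τ' hx hτ hτ' => ?_, fun b => ?_⟩
    · rcases hp.im_or_im t with ht | ht
      · exact TotalAt.of_comp_of_im (fun k _ _ _ _ => h₂ ▸ hstot k) ht
      · exact TotalAt.of_comp_of_im (fun a _ _ _ _ => h₁ ▸ hi₁ a) ht
    · by_cases hb : Im i b
      · have key : ∀ {t} {y y' : C.Ob} {τ : C.Hor y y'}, Rel d t b τ → Im c.inl t := fun hτ =>
          (hp.im_or_im _).resolve_left fun ht => (hsim b).1 (himr hτ ht) hb
        exact InjAt.of_comp_of_im (h₁ ▸ hi₂ b) (key hτ) (key hτ') hx hτ hτ'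
      · have key : ∀ {t} {y y' : C.Ob} {τ : C.Hor y y'}, Rel d t b τ → Im c.inr t := fun hτ =>
          (hp.im_or_im _).resolve_right fun ht => hb (himl hτ ht)
        exact InjAt.of_comp_of_im (h₂ ▸ hsinj b) (key hτ) (key hτ') hx hτ hτ'
    · by_cases hb : Im i b
      · rw [← h₁] at hb
        exact hb.of_comp
      · have := (hsim b).2 hb
        rw [← h₂] at this
        exact this.of_comp

end SC

namespace SC

open PolytopeComplex

variable {C D : PolytopeComplex.{v, u}} (F : C ⟶ D)

/-! ## Exactness of the induced functors -/

theorem exists_idxIncl {A : SC C} {i : A.Idx} (h : F.obj (A.elt i) ≠ D.bot) :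
    ∃ i' : (mapObj F A).Idx, idxIncl F A i' = i := ⟨⟨i.1, h⟩, rfl⟩

section

variable {A B : SC C}

/-- Components arriving at an index that survives under `F` survive too, since a horizontal morphism
cannot join a polytope to the initial object. -/
theorem map_elt_ne_bot (S : Span A B) {s : S.apex.Idx} {k : (mapObj F B).Idx}
    (h : S.f s = idxIncl F B k) : F.obj (S.apex.elt s) ≠ D.bot := by
  refine left_ne_bot (F.hmap (S.hor s)) ?_
  rw [h]
  exact k.2

variable {φ : A ⟶ B}

theorem im_map_iff {k : (mapObj F B).Idx} :
    Im ((map F).map φ) k ↔ Im φ (idxIncl F B k) := by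
  obtain ⟨S, rfl⟩ := exists_span φ
  refine ((mapSpan F S).im_iff k).trans (Iff.trans ?_ (S.im_iff _).symm)
  constructor
  · rintro ⟨s, rfl⟩
    exact ⟨idxIncl F _ s, rfl⟩
  · rintro ⟨s, hs⟩
    obtain ⟨s', rfl⟩ := exists_idxIncl F (map_elt_ne_bot F S hs)
    exact ⟨s', idxIncl_injective F B hs⟩

theorem Dom.map {i : (mapObj F A).Idx} {y : C.Ob} (h : Dom φ (idxIncl F A i) y)
    (hy : F.obj y ≠ D.bot) : Dom ((map F).map φ) i (F.obj y) := by
  obtain ⟨S, rfl⟩ := exists_span φ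
  obtain ⟨j, y', τ, s, h₁, rfl, h₂⟩ := h
  obtain ⟨s', rfl⟩ := exists_idxIncl F (ne_bot_of_le (F.mono (C.sq_left h₂)) hy)
  exact ⟨(mapSpan F S).f s', _, F.hmap τ, s', idxIncl_injective F A h₁, rfl, F.sq h₂⟩

theorem Rel.of_map {i : (mapObj F A).Idx} {k : (mapObj F B).Idx} {y y' : D.Ob} {τ : D.Hor y y'}
    (h : Rel ((SC.map F).map φ) i k τ) :
    ∃ (z z' : C.Ob) (ρ : C.Hor z z'), Rel φ (idxIncl F A i) (idxIncl F B k) ρ := by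
  obtain ⟨S, rfl⟩ := exists_span φ
  obtain ⟨s, rfl, rfl, -⟩ := h
  exact ⟨_, _, S.hor (idxIncl F _ s), idxIncl F _ s, rfl, rfl, C.sq_vid _⟩

theorem Rel.exists_map {i : A.Idx} {k : (mapObj F B).Idx} {y y' : C.Ob} {τ : C.Hor y y'}
    (h : Rel φ i (idxIncl F B k) τ) :
    ∃ i' : (mapObj F A).Idx, idxIncl F A i' = i ∧
      ∃ (z z' : D.Ob) (ρ : D.Hor z z'), Rel ((SC.map F).map φ) i' k ρ := by
  obtain ⟨S, rfl⟩ := exists_span φ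
  obtain ⟨s, rfl, hs, -⟩ := h
  obtain ⟨s', rfl⟩ := exists_idxIncl F (map_elt_ne_bot F S hs)
  exact ⟨(mapSpan F S).p s', rfl, _, _, (mapSpan F S).hor s', s', rfl,
    idxIncl_injective F B hs, D.sq_vid _⟩

theorem isCoveringSubmap_mapSpan {S : Span A B} (h : IsCoveringSubmap S.apex.elt A.elt S.p) :
    IsCoveringSubmap (mapSpan F S).apex.elt (mapObj F A).elt (mapSpan F S).p := by
  refine ⟨(mapSpan F S).sub, fun i => isCoveringFamily_iff.2 ⟨?_, ?_⟩⟩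
  · rintro ⟨s, rfl⟩
    exact (mapSpan F S).sub.le s
  -- The indices omitted because `F` sends them to the initial object do not affect the covering.
  · refine Cov.of_ne_bot i.2 (fun b c hbc ⟨s, hs⟩ => ⟨s, hbc.trans hs⟩) ?_
    refine (isCoveringFamily_iff.1 (F.isCoveringFamily (h.cover (idxIncl F A i)))).2.mono ?_
    rintro y - ⟨⟨s, hs⟩, hy⟩ hne
    obtain ⟨s', rfl⟩ := exists_idxIncl F (ne_bot_of_le hy hne)
    exact ⟨⟨s', idxIncl_injective F A hs⟩, hy⟩

theorem injective_mapSpan {S : Span A B} (h : Function.Injective S.f) :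
    Function.Injective (mapSpan F S).f := fun _ _ hs =>
  idxIncl_injective F _ (h (congrArg (idxIncl F B) hs))

theorem cof_map (h : cof C φ) : cof D ((map F).map φ) := by
  obtain ⟨S, rfl, h₁, h₂⟩ := h
  exact ⟨mapSpan F S, rfl, isCoveringSubmap_mapSpan F h₁, injective_mapSpan F h₂⟩

theorem weq_map (h : weq C φ) : weq D ((map F).map φ) := by
  have h' := cof_iff.1 (cof_map F (cof_of_weq h))
  exact weq_iff.2 ⟨h'.1, h'.2, fun k => (im_map_iff F).2 ((weq_iff.1 h).2.2 _)⟩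

end

theorem PushoutFacts.map {A B X P : SC C} {i : A ⟶ B} {f : A ⟶ X} {g : B ⟶ P} {j : X ⟶ P}
    (h : PushoutFacts i f g j) :
    PushoutFacts ((SC.map F).map i) ((SC.map F).map f) ((SC.map F).map g) ((SC.map F).map j) := by
  obtain ⟨h₁, h₂⟩ := cof_iff.1 (cof_map F (cof_iff.2 ⟨h.total, h.inj⟩))
  refine ⟨by rw [← Functor.map_comp, h.comm, Functor.map_comp], h₁, h₂, fun k => ?_,
    fun b hb => ?_, ?_, ?_⟩
  · rcases h.im_or (idxIncl F P k) with hk | ⟨b, hb, y, y', τ, hτ⟩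
    · exact Or.inl ((im_map_iff F).2 hk)
    · obtain ⟨b', rfl, h₃⟩ := Rel.exists_map F hτ
      exact Or.inr ⟨b', mt (im_map_iff F).1 hb, h₃⟩
  · exact (h.dom _ (mt (im_map_iff F).2 hb)).map F b.2
  · intro b k y y' τ hτ hb
    obtain ⟨_, _, _, h₃⟩ := Rel.of_map F hτ
    exact mt (im_map_iff F).1 (h.not_im h₃ (mt (im_map_iff F).2 hb))
  · intro b b' k y y' z z' τ τ' hτ hτ' hb hb'
    obtain ⟨_, _, _, h₃⟩ := Rel.of_map F hτ
    obtain ⟨_, _, _, h₄⟩ := Rel.of_map F hτ'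
    exact idxIncl_injective F B
      (h.eq_of_rel h₃ h₄ (mt (im_map_iff F).2 hb) (mt (im_map_iff F).2 hb'))

/-- Over a surviving index every component of `S` survives, so a choice for the image diagrams lifts
to a choice in `C`. Its piece is sent by `F` to the corresponding piece in `D`. -/
theorem IsMaximal.map {A B X P : SC C} {Q : Span A B} {S : Span A X} {j : X ⟶ P}
    (h : IsMaximal Q S j) : IsMaximal (mapSpan F Q) (mapSpan F S) ((SC.map F).map j) := by
  intro x c hc m hm hpiece
  choose l hl using fun s : {s // S.f s = idxIncl F X x} =>
    exists_idxIncl F (map_elt_ne_bot F S s.2)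
  have hlx : ∀ s, (mapSpan F S).f (l s) = x := fun s =>
    idxIncl_injective F X ((congrArg S.f (hl s)).trans s.2)
  have hc' : ∀ s, Q.p (idxIncl F _ (c ⟨l s, hlx s⟩)) = S.p s.1 := fun s =>
    (congrArg (idxIncl F A) (hc ⟨l s, hlx s⟩)).trans (congrArg S.p (hl s))
  obtain ⟨m₀, h₁, h₂⟩ := exists_isPiece F
    (fun s : {s // S.f s = idxIncl F X x} => S.hor s.1)
    (b₀ := X.elt (idxIncl F X x)) (fun s => by rw [s.2])
    (fun s => Q.apex.elt (idxIncl F _ (c ⟨l s, hlx s⟩)))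
    (fun s => ⟨A.elt (S.p s.1), S.sub.le _, by rw [← hc']; exact Q.sub.le _⟩)
  have hle : m ≤ F.obj m₀ := by
    refine h₂.max m hpiece.le fun s => ?_
    have h₃ : PullLe (F.hmap (S.hor (idxIncl F S.apex (l s))))
      (F.obj (Q.apex.elt (idxIncl F _ (c ⟨l s, hlx s⟩)))) m := hpiece.pullLe ⟨l s, hlx s⟩
    rwa [hl] at h₃
  have hne := ne_bot_of_le hle hm
  refine ((h _ _ hc' m₀ (fun hb => hne ?_) h₁).map F hne).le hle
  rw [hb, F.map_bot]

theorem isExactFunctor_map :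
    IsExactFunctor (cof C) (weq C) (cof D) (weq D) (map F) where
  map_zero h := by
    have := isEmpty_of_isZero h
    exact isZero_of_isEmpty ⟨fun i => isEmptyElim (idxIncl F _ i)⟩
  map_co _ h := cof_map F h
  map_w _ h := weq_map F h
  map_pushout {A B X P i f g j} h hi := by
    obtain ⟨h₁, h₂⟩ := cof_iff.1 hi
    obtain ⟨Q, rfl⟩ := exists_span i
    obtain ⟨S, rfl⟩ := exists_span f
    obtain ⟨P₀, g₀, j₀, h₃, h₄⟩ := exists_pushout Q S h₁ (Q.injective_iff.2 h₂)
    have h₅ : IsPushout ((map F).map Q.hom) ((map F).map S.hom) ((map F).map g₀)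
      ((map F).map j₀) := (h₃.map F).isPushout (h₄.map F)
    refine h₅.of_iso (Iso.refl _) (Iso.refl _) (Iso.refl _)
      ((map F).mapIso (IsPushout.isoIsPushout _ _ (h₃.isPushout h₄) h)) (by simp) (by simp) ?_ ?_
    · simp [← Functor.map_comp]
    · simp [← Functor.map_comp]

/-- The functor `SC` into Waldhausen categories. -/
noncomputable def waldFunctor : PolytopeComplex.{v, u} ⥤ WaldCat.{max u v, u} where
  obj C := { SC.functor.obj C with isWaldhausen := isWaldhausen C }
  map F := ⟨map F, isExactFunctor_map F⟩
  map_id C := Subtype.ext (map_id C)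
  map_comp F G := Subtype.ext (map_comp F G)

theorem waldFunctor_comp_forget :
    waldFunctor.{v, u} ⋙ WaldCat.forget = SC.functor := rfl

end SC

namespace SC

open PolytopeComplex

variable {C : PolytopeComplex.{v, u}}

/-! ## The group `K₀` -/

/-- The members of a family, as polytopes. -/
def polytope (A : SC C) (i : A.Idx) : C.Polytope := ⟨A.elt i, i.2⟩

noncomputable instance (A : SC C) : Fintype A.Idx := Fintype.ofFinite _

/-- The index of the only member of `{a}`. -/
noncomputable def singleIdx (a : C.Polytope) : (single a).Idx := ⟨0, a.2⟩

theorem eq_singleIdx {a : C.Polytope} (i : (single a).Idx) : i = singleIdx a := by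
  refine Subtype.ext ?_
  by_contra h
  exact i.2 (if_neg h)

theorem single_elt {a : C.Polytope} (i : (single a).Idx) : (single a).elt i = a.1 := by
  rw [eq_singleIdx i]
  rfl

noncomputable instance (a : C.Polytope) : Unique (single a).Idx := ⟨⟨singleIdx a⟩, eq_singleIdx⟩

/-- A cofibration with prescribed components. -/
theorem exists_cof {A B : SC C} {I : Type} [Finite I] (x : I → C.Ob) (hx : ∀ s, x s ≠ C.bot)
    (p : I → A.Idx) (f : I → B.Idx) (hor : ∀ s, C.Hor (x s) (B.elt (f s)))
    (hsub : IsSubmap x A.elt p)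
    (hcov : ∀ i, Cov (A.elt i) (fun y => ∃ s, p s = i ∧ y ≤ x s)) (hf : Function.Injective f) :
    ∃ φ : A ⟶ B, cof C φ ∧ ∀ j, Im φ j ↔ ∃ s, f s = j := by
  obtain ⟨φ, hφ⟩ := exists_hom x hx p f hor hsub.le fun s s' w hw hp h₁ h₂ => by
    by_contra hne
    exact hw (isGLB_bot_iff.1 (hsub.disjoint s s' hne hp) w h₁ h₂)
  refine ⟨φ, cof_iff.2 ⟨fun i => (hcov i).mono ?_, ?_⟩, fun j => ⟨?_, ?_⟩⟩
  · rintro y - ⟨s, rfl, hs⟩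
    exact Dom.le (Rel.dom ((hφ _ _ _ _ _).2 ⟨s, rfl, rfl, C.sq_vid _⟩)) hs
  · rintro j i i' y z m τ τ' hm h h'
    obtain ⟨s, rfl, rfl, h₁⟩ := (hφ _ _ _ _ _).1 h
    obtain ⟨s', rfl, h₂, h₃⟩ := (hφ _ _ _ _ _).1 h'
    obtain rfl := hf h₂
    exact ⟨rfl, C.sq_unique h₁ h₃⟩
  · rintro ⟨i, y, y', τ, hτ⟩
    obtain ⟨s, -, hs, -⟩ := (hφ _ _ _ _ _).1 hτ
    exact ⟨s, hs⟩
  · rintro ⟨s, rfl⟩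
    exact ⟨_, _, _, _, (hφ _ _ _ _ _).2 ⟨s, rfl, rfl, C.sq_vid _⟩⟩

theorem weq_of_cof {A B : SC C} {φ : A ⟶ B} (h : cof C φ) (h' : ∀ j, Im φ j) : weq C φ :=
  weq_iff.2 ⟨(cof_iff.1 h).1, (cof_iff.1 h).2, h'⟩

/-- With the zero object in place of `X`, maximality is vacuous, so the facts alone give the
pushout. -/
theorem CofiberFacts.isCofibrationSequence {A B Q : SC C} {i : A ⟶ B} {q : B ⟶ Q}
    (h : CofiberFacts i q) (hi : cof C i) : IsCofibrationSequence (cof C) i q := by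
  refine ⟨hi, empty C, (isZero_empty C).from_ A, (isZero_empty C).to_ Q, isZero_empty C, ?_⟩
  have h₁ : PushoutFacts i ((isZero_empty C).from_ A) q ((isZero_empty C).to_ Q) := by
    refine ⟨hom_ext fun a k y y' τ _ => ⟨fun hτ => ?_, fun hτ => ?_⟩, fun x => isEmptyElim x,
      fun k x => isEmptyElim x, fun k => Or.inr ?_, h.dom, fun _ _ ⟨x, _⟩ => isEmptyElim x, ?_⟩
    · obtain ⟨b, x, τ₁, τ₂, -, h₁, h₂⟩ := hτ.of_comp
      exact absurd h₁.im (h.not_im h₂)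
    · obtain ⟨x, -⟩ := hτ.of_comp
      exact isEmptyElim x
    · obtain ⟨b, y, y', τ, hτ⟩ := h.im k
      exact ⟨b, h.not_im hτ, y, y', τ, hτ⟩
    · intro b b' k y y' z z' τ τ' hτ hτ' _ _
      obtain ⟨x, ρ, hρ, -⟩ := hτ.exists_component
      obtain ⟨x', ρ', hρ', -⟩ := hτ'.exists_component
      exact (h.inj k (Q.elt_ne_bot k) hρ hρ').1
  generalize (isZero_empty C).from_ A = f at h₁ ⊢
  obtain ⟨S, rfl⟩ := exists_span f
  obtain ⟨T, rfl⟩ := exists_span i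
  exact h₁.isPushout fun x => isEmptyElim x

theorem k0_weq {A B : SC C} {φ : A ⟶ B} (h : weq C φ) :
    K0.of (cof C) (weq C) A = K0.of (cof C) (weq C) B :=
  (QuotientAddGroup.eq_iff_sub_mem).2 (AddSubgroup.subset_closure (K0Rel.weq φ h))

theorem k0_cof {A B Q : SC C} {i : A ⟶ B} {q : B ⟶ Q} (h : IsCofibrationSequence (cof C) i q) :
    K0.of (cof C) (weq C) B = K0.of (cof C) (weq C) A + K0.of (cof C) (weq C) Q :=
  (QuotientAddGroup.eq_iff_sub_mem).2 (AddSubgroup.subset_closure (K0Rel.cof i q h))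

/-- Z → Z → Z is a cofibration sequence, so [Z] = [Z] + [Z]. -/
theorem k0_of_isZero {Z : SC C} (h : IsZero Z) : K0.of (cof C) (weq C) Z = 0 := by
  have : K0.of (cof C) (weq C) Z = K0.of (cof C) (weq C) Z + K0.of (cof C) (weq C) Z :=
    k0_cof (i := 𝟙 Z) (q := 𝟙 Z)
      ⟨cof_of_isZero h _, Z, 𝟙 Z, 𝟙 Z, h, IsPushout.of_id_fst⟩
  exact left_eq_add.1 this

/-- Splitting off the member with index `i₀`. -/
theorem exists_isCofibrationSequence_single {T R : SC C} (i₀ : T.Idx)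
    (e : R.Idx ≃ {i : T.Idx // i ≠ i₀}) (he : ∀ k, R.elt k = T.elt (e k).1) :
    ∃ (i : single (T.polytope i₀) ⟶ T) (q : T ⟶ R), IsCofibrationSequence (cof C) i q := by
  obtain ⟨i, hi, him⟩ := exists_cof (A := single (T.polytope i₀)) (B := T) (I := Unit)
    (fun _ => T.elt i₀) (fun _ => T.elt_ne_bot _) (fun _ => singleIdx _) (fun _ => i₀)
    (fun _ => C.hid _) ⟨fun _ => le_rfl, fun _ _ h => absurd rfl h⟩
    (fun k => Cov.of_forall fun y hy => ⟨(), (eq_singleIdx k).symm, by rwa [single_elt] at hy⟩)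
    (fun _ _ _ => rfl)
  obtain ⟨q, hq⟩ := exists_hom (A := T) (B := R) (fun k : R.Idx => R.elt k) R.elt_ne_bot
    (fun k => (e k).1) id (fun k => C.hid _) (fun k => (he k).le)
    (fun k k' _ _ h _ _ => e.injective (Subtype.ext h))
  refine ⟨i, q, CofiberFacts.isCofibrationSequence ⟨fun k => ?_, fun b hb => ?_, ?_, ?_⟩ hi⟩
  · exact ⟨_, _, _, _, (hq _ _ _ _ _).2 ⟨k, rfl, rfl, C.sq_vid _⟩⟩
  · have hb' : b ≠ i₀ := fun h => hb ((him b).2 ⟨(), h.symm⟩)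
    obtain ⟨k, hk⟩ := e.surjective ⟨b, hb'⟩
    refine Dom.le (Rel.dom ((hq _ _ _ _ _).2 ⟨k, congrArg Subtype.val hk, rfl, C.sq_vid _⟩)) ?_
    rw [he, hk]
  · intro b k y y' τ hτ hb
    obtain ⟨k, rfl, -, -⟩ := (hq _ _ _ _ _).1 hτ
    obtain ⟨-, h⟩ := (him _).1 hb
    exact (e k).2 h.symm
  · rintro k b b' y z x τ τ' hx hτ hτ'
    obtain ⟨k, rfl, rfl, h₁⟩ := (hq _ _ _ _ _).1 hτ
    obtain ⟨k', rfl, h₂, h₃⟩ := (hq _ _ _ _ _).1 hτ'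
    obtain rfl : k' = k := h₂
    exact ⟨rfl, C.sq_unique h₁ h₃⟩

theorem k0_eq_sum_fin (n : ℕ) : ∀ (T : SC C) (e : T.Idx ≃ Fin n),
    K0.of (cof C) (weq C) T =
      ∑ i, K0.of (cof C) (weq C) (single (T.polytope (e.symm i))) := by
  induction n with
  | zero =>
    intro T e
    have : IsEmpty T.Idx := e.isEmpty
    rw [k0_of_isZero (isZero_of_isEmpty this), Finset.univ_eq_empty, Finset.sum_empty]
  | succ n ih =>
    intro T e
    -- `R` collects the members numbered 1 to n and is the cofiber of the inclusion of member 0.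
    obtain ⟨R, e', he'⟩ := exists_obj (I := Fin n) (fun i => T.elt (e.symm i.succ))
      (fun i => T.elt_ne_bot _)
    obtain ⟨i, q, h⟩ := exists_isCofibrationSequence_single (T := T) (R := R) (e.symm 0)
      ((e'.trans (finSuccAboveEquiv 0)).trans
        (e.symm.subtypeEquiv fun k => by simp)) (fun k => by rw [he']; rfl)
    rw [k0_cof h, Fin.sum_univ_succ, ih R e']
    congr 1
    refine Finset.sum_congr rfl fun k _ => ?_
    congr 2
    refine Subtype.ext ?_
    change R.elt _ = T.elt _
    rw [he', Equiv.apply_symm_apply]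

theorem k0_eq_sum {I : Type} [Fintype I] (T : SC C) (e : T.Idx ≃ I) :
    K0.of (cof C) (weq C) T =
      ∑ i, K0.of (cof C) (weq C) (single (T.polytope (e.symm i))) := by
  rw [k0_eq_sum_fin _ T (e.trans (Fintype.equivFin I)),
    ← (Fintype.equivFin I).sum_comp]
  simp

theorem k0_single_hor (a b : C.Polytope) (σ : C.Hor a.1 b.1) :
    K0.of (cof C) (weq C) (single a) = K0.of (cof C) (weq C) (single b) := by
  obtain ⟨φ, h, him⟩ := exists_cof (A := single a) (B := single b) (I := Unit)
    (fun _ => a.1) (fun _ => a.2) (fun _ => singleIdx _) (fun _ => singleIdx _)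
    (fun _ => σ) ⟨fun _ => le_rfl, fun _ _ h => absurd rfl h⟩
    (fun k => Cov.of_forall fun y hy => ⟨(), (eq_singleIdx k).symm, by rwa [single_elt] at hy⟩)
    (fun _ _ _ => rfl)
  exact k0_weq (weq_of_cof h fun j => (him j).2 ⟨(), (eq_singleIdx j).symm⟩)

theorem k0_single_cover {I : Type} [Fintype I] (x : I → C.Polytope) (a : C.Polytope)
    (h : IsCoveringSubmap (fun i => (x i).1) (fun _ : Unit => a.1) (fun _ => ())) :
    K0.of (cof C) (weq C) (single a) = ∑ i, K0.of (cof C) (weq C) (single (x i)) := by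
  obtain ⟨T, e, he⟩ := exists_obj (I := I) (fun i => (x i).1) (fun i => (x i).2)
  have he' : ∀ i, T.elt (e.symm i) = (x i).1 := fun i => by rw [he, Equiv.apply_symm_apply]
  obtain ⟨φ, hφ, him⟩ := exists_cof (A := single a) (B := T) (I := I)
    (fun i => T.elt (e.symm i)) (fun _ => T.elt_ne_bot _) (fun _ => singleIdx _) e.symm
    (fun _ => C.hid _)
    ⟨fun i => by rw [he', single_elt]; exact h.le i, fun i i' hne _ => by
      rw [he', he']; exact h.disjoint i i' hne rfl⟩
    (fun k => by
      rw [single_elt]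
      refine (isCoveringFamily_iff.1 (h.cover ())).2.mono ?_
      rintro y - ⟨i, hi⟩
      exact ⟨i.1, (eq_singleIdx k).symm, by rw [he']; exact hi⟩)
    e.symm.injective
  rw [k0_weq (weq_of_cof hφ fun j => (him j).2 (e.symm.surjective j)), k0_eq_sum T e]
  refine Finset.sum_congr rfl fun i _ => ?_
  congr 2
  exact Subtype.ext (he' i)

/-! ### The class of a family in the scissors congruence group -/

theorem scissors_hor {a b : C.Polytope} (σ : C.Hor a.1 b.1) :
    ScissorsGroup.of a = ScissorsGroup.of b :=
  (QuotientAddGroup.eq_iff_sub_mem).2 (AddSubgroup.subset_closure (ScissorsRel.hor a b σ))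

theorem scissors_cover {I : Type} [Fintype I] (x : I → C.Polytope) (a : C.Polytope)
    (h : IsCoveringSubmap (fun i => (x i).1) (fun _ : Unit => a.1) (fun _ => ())) :
    ScissorsGroup.of a = ∑ i, ScissorsGroup.of (x i) := by
  have := (QuotientAddGroup.eq_iff_sub_mem).2
    (AddSubgroup.subset_closure (k := {x | ScissorsRel C x}) (ScissorsRel.cover x a h))
  refine this.trans ?_
  exact map_sum (QuotientAddGroup.mk' _) _ _

/-- The sum of the classes of the members of a family. -/
noncomputable def scissorsClass (A : SC C) : ScissorsGroup C :=
  ∑ i, ScissorsGroup.of (A.polytope i)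

/-- The covering relation replaces each member of `A` by the components over it, and the horizontal
relation replaces each component by its target in `B`. -/
theorem scissorsClass_of_covering {A B : SC C} (S : Span A B)
    (h : IsCoveringSubmap S.apex.elt A.elt S.p) :
    scissorsClass A = ∑ s, ScissorsGroup.of (B.polytope (S.f s)) := by
  classical
  have h₁ : ∀ i, ScissorsGroup.of (A.polytope i) =
      ∑ s : {s // S.p s = i}, ScissorsGroup.of (S.apex.polytope s.1) := by
    intro i
    refine scissors_cover _ _ ⟨⟨?_, ?_⟩, fun _ => ?_⟩
    · rintro ⟨s, rfl⟩
      exact h.le s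
    · rintro ⟨s, hs⟩ ⟨s', hs'⟩ hne -
      exact h.disjoint s s' (fun h => hne (Subtype.ext h)) (hs.trans hs'.symm)
    · have := isCoveringFamily_iff.1 (h.cover i)
      exact isCoveringFamily_iff.2 ⟨fun s => this.1 s.1, this.2.mono fun y _ ⟨s, hs⟩ =>
        ⟨⟨s, rfl⟩, hs⟩⟩
  unfold scissorsClass
  rw [Finset.sum_congr rfl fun i _ => h₁ i]
  refine (Fintype.sum_fiberwise S.p fun s => ScissorsGroup.of (S.apex.polytope s)).trans ?_
  exact Finset.sum_congr rfl fun s _ => scissors_hor (S.hor s)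

theorem scissorsClass_weq {A B : SC C} {φ : A ⟶ B} (h : weq C φ) :
    scissorsClass A = scissorsClass B := by
  obtain ⟨S, rfl, h₁, h₂⟩ := h
  rw [scissorsClass_of_covering S h₁]
  exact h₂.sum_comp fun j => ScissorsGroup.of (B.polytope j)

/-- The canonical section is a cofibration whose image is the complement of that of `i`. The targets
of the components of the two maps thus enumerate the members of `B` exactly once. -/
theorem scissorsClass_cof {A B Q : SC C} {i : A ⟶ B} {q : B ⟶ Q}
    (h : IsCofibrationSequence (cof C) i q) :
    scissorsClass B = scissorsClass A + scissorsClass Q := by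
  have hq := CofiberFacts.of_isCofibrationSequence h
  obtain ⟨s, hs⟩ := hq.exists_section
  have him := hq.im_reverse_iff hs
  obtain ⟨S, rfl, h₁, h₂⟩ := h.co
  obtain ⟨T, rfl, h₃, h₄⟩ := hq.cof_reverse hs
  simp only [Span.im_iff] at him
  rw [scissorsClass_of_covering S h₁, scissorsClass_of_covering T h₃]
  have hbij : Function.Bijective (Sum.elim S.f T.f) := by
    refine ⟨h₂.sumElim h₄ fun a b hab => (him (T.f b)).1 ⟨b, rfl⟩ ⟨a, hab⟩, fun b => ?_⟩
    by_cases hb : ∃ s, S.f s = b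
    · obtain ⟨s, rfl⟩ := hb
      exact ⟨Sum.inl s, rfl⟩
    · obtain ⟨t, rfl⟩ := (him b).2 hb
      exact ⟨Sum.inr t, rfl⟩
  have := hbij.sum_comp fun j => ScissorsGroup.of (B.polytope j)
  rw [Fintype.sum_sum_type] at this
  exact this.symm

theorem scissorsClass_single (a : C.Polytope) : scissorsClass (single a) = ScissorsGroup.of a := by
  unfold scissorsClass
  rw [Fintype.sum_unique]
  rfl

/-- The homomorphism `[a] ↦ [{a}]`. -/
noncomputable def scissorsToK0 (C : PolytopeComplex.{v, u}) :
    ScissorsGroup C →+ K0 (cof C) (weq C) :=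
  QuotientAddGroup.lift _ (FreeAbelianGroup.lift fun a => K0.of (cof C) (weq C) (single a)) (by
    rw [AddSubgroup.closure_le]
    rintro _ (⟨x, a, h⟩ | ⟨a, b, σ⟩)
    · simp [k0_single_cover x a h]
    · simp [k0_single_hor a b σ])

theorem scissorsToK0_of (a : C.Polytope) :
    scissorsToK0 C (ScissorsGroup.of a) = K0.of (cof C) (weq C) (single a) :=
  FreeAbelianGroup.lift_apply_of _ _

/-- The homomorphism `[{a_i}] ↦ ∑ [a_i]`. -/
noncomputable def k0ToScissors (C : PolytopeComplex.{v, u}) :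
    K0 (cof C) (weq C) →+ ScissorsGroup C :=
  QuotientAddGroup.lift _ (FreeAbelianGroup.lift scissorsClass) (by
    rw [AddSubgroup.closure_le]
    rintro _ (⟨φ, h⟩ | ⟨i, q, h⟩)
    · simp [scissorsClass_weq h]
    · simp [scissorsClass_cof h])

theorem k0ToScissors_of (A : SC C) :
    k0ToScissors C (K0.of (cof C) (weq C) A) = scissorsClass A :=
  FreeAbelianGroup.lift_apply_of _ _

/-- The isomorphism `[a] ↦ [{a}]` from the scissors congruence group onto `K₀`. -/
noncomputable def scissorsEquivK0 (C : PolytopeComplex.{v, u}) :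
    ScissorsGroup C ≃+ K0 (cof C) (weq C) :=
  AddMonoidHom.toAddEquiv (scissorsToK0 C) (k0ToScissors C)
    (by
      refine QuotientAddGroup.addMonoidHom_ext _ (FreeAbelianGroup.lift_ext _ _ fun a => ?_)
      change k0ToScissors C (scissorsToK0 C (ScissorsGroup.of a)) = ScissorsGroup.of a
      rw [scissorsToK0_of, k0ToScissors_of, scissorsClass_single])
    (by
      refine QuotientAddGroup.addMonoidHom_ext _ (FreeAbelianGroup.lift_ext _ _ fun A => ?_)
      change scissorsToK0 C (k0ToScissors C (K0.of (cof C) (weq C) A)) = K0.of (cof C) (weq C) A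
      rw [k0ToScissors_of, k0_eq_sum A (Equiv.refl _), scissorsClass, map_sum]
      exact Finset.sum_congr rfl fun i _ => scissorsToK0_of _)

end SC

theorem mainTheorem1 :
    (∃ Φ : PolytopeComplex.{v, u} ⥤ WaldCat.{max u v, u}, Φ ⋙ WaldCat.forget = SC.functor) ∧
    ∀ C : PolytopeComplex.{v, u},
      (SC.weq C).HasTwoOutOfThreeProperty ∧
      ExtensionAxiom (SC.cof C) (SC.weq C) ∧
      HasCanonicalSplittings (SC.cof C) (SC.weq C) ∧
      ∃ e : ScissorsGroup C ≃+ K0 (SC.cof C) (SC.weq C),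
        ∀ a : C.Polytope, e (ScissorsGroup.of a) = K0.of (SC.cof C) (SC.weq C) (SC.single a) := by
  exact ⟨⟨SC.waldFunctor, SC.waldFunctor_comp_forget⟩, fun C =>
    ⟨SC.weq_hasTwoOutOfThreeProperty C, SC.extensionAxiom C, SC.hasCanonicalSplittings C,
      SC.scissorsEquivK0 C, SC.scissorsToK0_of⟩⟩
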